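/- Conventions. Complex manifolds are finite-dimensional, Hausdorff and second countable. For a connected complex manifold $M$, let $\mathsf{k}_M$ be its Kobayashi pseudodistance (normalized by the Poincaré distance $\rho(a,b)=\tanh^{-1}\bigl|\tfrac{a-b}{1-\bar b a}\bigr|$ of the unit disc $\mathbb{D}$) and $\kappa_M(x;v)=\inf\{\alpha>0:\exists f:\mathbb{D}\to M \text{ holomorphic},\ f(0)=x,\ \alpha f'(0)=v\}$ its Kobayashi (Royden) pseudometric. $M$ is Kobayashi hyperbolic if $\mathsf{k}_M$ is a distance, and complete Kobayashi hyperbolic if moreover $(M,\mathsf{k}_M)$ is a complete metric space. Metric compactification. Let $C_*(M)$ be the quotient of the space $C(M)$ of real continuous functions (with locally uniform convergence) by the constants, with the quotient topology, and let $i_{\mathsf{k}}:M\to C_*(M)$, $i_{\mathsf{k}}(x)=[\mathsf{k}_M(x,\cdot)]$. Then $\overline{M}^{\mathsf{k}}$ is the closure of $i_{\mathsf{k}}(M)$ in $C_*(M)$. End compactification. Let $\Omega\subsetneq Y$ be a domain (a nonempty connected open proper subset) of a complex manifold $Y$, with closure $\overline\Omega$ in $Y$, and let $(K_j)$ be a compact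 exhaustion of $\overline\Omega$ with $K_j\subset\operatorname{int}K_{j+1}$. An end is a decreasing sequence $(F_j)$ with $F_j$ a connected component of $\overline\Omega\setminus K_j$. Then $\overline\Omega^{\rm End}$ is the disjoint union of $\overline\Omega$ and the set of ends, topologized as follows: a point of $\overline\Omega$ has its neighbourhoods in $\overline\Omega$ as a neighbourhood basis, and an end $(F_j)$ has the basis of sets $F_j\sqcup\{\text{ends }(G_\nu): G_\nu=F_\nu\text{ for all }\nu\le j\}$. Visibility. For $\lambda\ge 1$, $\kappa>0$, a $(\lambda,\kappa)$-almost-geodesic in a Kobayashi hyperbolic domain $\Omega$ is an absolutely continuous curve $\sigma:[0,T]\to\Omega$ with $\tfrac1\lambda|s-t|-\kappa\le\mathsf{k}_\Omega(\sigma(s),\sigma(t))\le\lambda|s-t|+\kappa$ for all $s,t\in[0,T]$ and $\kappa_\Omega(\sigma(t);\sigma'(t))\le\lambda$ for almost every $t$. The domain $\Omega$ satisfies the visibility property if for all $\lambda\ge1$, $\kappa>0$ and all distinct $p,q\in\partial\Omega$ there are neighbourhoods $U$ of $p$ and $V$ of $q$ in $Y$ with $\overline U\cap\overline V=\emptyset$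 and a compact set $C\subset\Omega$ such that every $(\lambda,\kappa)$-almost-geodesic $\sigma:[0,T]\to\Omega$ with $\sigma(0)\in U$ and $\sigma(T)\in V$ meets $C$. Theorem. Let $X$ be a connected complete Kobayashi hyperbolic complex manifold, and let $\Omega\subsetneq Y$ be a Kobayashi hyperbolic domain in a complex manifold $Y$ that satisfies the visibility property. Let $F:X\to\Omega$ be a continuous quasi-isometric embedding, that is, $F$ is continuous and there are $\lambda\ge1$, $\kappa\ge0$ with $$\tfrac1\lambda\,\mathsf{k}_X(x,y)-\kappa\le\mathsf{k}_\Omega(F(x),F(y))\le\lambda\,\mathsf{k}_X(x,y)+\kappa\qquad\text{for all }x,y\in X.$$ Then there is a continuous map $\widetilde F:\overline{X}^{\mathsf{k}}\to\overline\Omega^{\rm End}$ with $\widetilde F(i_{\mathsf{k}}(x))=F(x)$ for all $x\in X$. -/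

import Mathlib

open scoped Manifold Topology
open Set Filter MeasureTheory

noncomputable section

/-! ### The Kobayashi distance and the Kobayashi metric -/

/-- The Poincaré distance on the unit disc (curvature `-4`):
`ρ(a, b) = artanh (|a - b| / |1 - conj b * a|)`. -/
def poincareDist (a b : ℂ) : ℝ :=
  Real.artanh (‖a - b‖ / ‖1 - (starRingEnd ℂ) b * a‖)

section Kobayashi

variable (E : Type*) [NormedAddCommGroup E] [NormedSpace ℂ E]
variable {X : Type*} [TopologicalSpace X] [ChartedSpace E X]

/-- `f` restricts to a holomorphic map from the open unit disc to `X`. -/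
def IsHolomorphicDisc (f : ℂ → X) : Prop :=
  MDifferentiableOn 𝓘(ℂ, ℂ) 𝓘(ℂ, E) f (Metric.ball (0 : ℂ) 1)

/-- `DiscChain E x y L`: the points `x` and `y` are joined by a finite chain of holomorphic
discs `f₁, …, fₘ` with points `aᵢ, bᵢ` of the unit disc such that `f₁ a₁ = x`,
`fᵢ bᵢ = fᵢ₊₁ aᵢ₊₁`, `fₘ bₘ = y`, and `L = ∑ ρ(aᵢ, bᵢ)`. -/
inductive DiscChain : X → X → ℝ → Prop
  | nil (x : X) : DiscChain x x 0
  | cons (f : ℂ → X) (a b : ℂ) (y : X) (L : ℝ) (hf : IsHolomorphicDisc E f)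
      (ha : a ∈ Metric.ball (0 : ℂ) 1) (hb : b ∈ Metric.ball (0 : ℂ) 1)
      (h : DiscChain (f b) y L) : DiscChain (f a) y (poincareDist a b + L)

/-- The Kobayashi pseudodistance. (The infimum is over a nonempty set when `X` is connected,
see `exists_discChain`.) -/
def kobayashiDist (x y : X) : ℝ :=
  sInf {L : ℝ | DiscChain E x y L}

/-- The Kobayashi (Royden) pseudometric
`κ(x; v) = inf {α > 0 | ∃ f : 𝔻 → X holomorphic, f 0 = x, α f'(0) = v}`.
Tangent vectors at `x` are written, as everywhere in Mathlib, in the preferred chart at `x`. -/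
def kobayashiMetric (x : X) (v : E) : ℝ :=
  sInf {α : ℝ | 0 < α ∧ ∃ f : ℂ → X, IsHolomorphicDisc E f ∧ f 0 = x ∧
    (α : ℂ) • (mfderiv 𝓘(ℂ, ℂ) 𝓘(ℂ, E) f 0 (1 : ℂ) : E) = v}

variable (X) in
/-- `X` is Kobayashi hyperbolic: the Kobayashi pseudodistance separates points. -/
def IsKobayashiHyperbolic : Prop :=
  ∀ x y : X, kobayashiDist E x y = 0 → x = y

theorem poincareDist_nonneg (a b : ℂ) : 0 ≤ poincareDist a b :=
  Real.artanh_nonneg (by positivity)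

theorem poincareDist_comm (a b : ℂ) : poincareDist a b = poincareDist b a := by
  unfold poincareDist
  rw [norm_sub_rev a b]
  congr 2
  rw [← Complex.norm_conj (1 - (starRingEnd ℂ) b * a)]
  simp [mul_comm]

variable {E}

theorem DiscChain.nonneg {x y : X} {L : ℝ} (h : DiscChain E x y L) : 0 ≤ L := by
  induction h with
  | nil x => exact le_rfl
  | cons f a b y L hf ha hb h ih => exact add_nonneg (poincareDist_nonneg a b) ih

theorem DiscChain.trans {x y z : X} {L M : ℝ} (h : DiscChain E x y L) (h' : DiscChain E y z M) :
    DiscChain E x z (L + M) := by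
  induction h with
  | nil x => simpa using h'
  | cons f a b y L hf ha hb h ih =>
    rw [add_assoc]
    exact DiscChain.cons f a b z (L + M) hf ha hb (ih h')

theorem DiscChain.symm {x y : X} {L : ℝ} (h : DiscChain E x y L) : DiscChain E y x L := by
  induction h with
  | nil x => exact DiscChain.nil x
  | cons f a b y L hf ha hb h ih =>
    have h1 : DiscChain E (f b) (f a) (poincareDist b a + 0) :=
      DiscChain.cons f b a (f a) 0 hf hb ha (DiscChain.nil _)
    have h2 := ih.trans h1
    rwa [add_zero, poincareDist_comm b a, add_comm] at h2

/-- Points in a coordinate ball are joined by a holomorphic disc. -/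
theorem eventually_discChain [IsManifold 𝓘(ℂ, E) 1 X] (p : X) :
    ∀ᶠ q in 𝓝 p, ∃ L, DiscChain E p q L := by
  set φ := chartAt E p with hφ
  have hp : p ∈ φ.source := mem_chart_source E p
  obtain ⟨r, hr, hball⟩ := Metric.isOpen_iff.1 φ.open_target (φ p) (φ.map_source hp)
  have hnear : ∀ᶠ q in 𝓝 p, φ q ∈ Metric.ball (φ p) (r / 2) :=
    (φ.continuousAt hp).eventually (Metric.ball_mem_nhds _ (half_pos hr))
  filter_upwards [hnear, φ.open_source.mem_nhds hp] with q hq hqs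
  set v : E := (2 : ℂ) • (φ q - φ p) with hv
  have hvn : ‖v‖ < r := by
    rw [hv, norm_smul]
    rw [mem_ball_iff_norm] at hq
    simp only [Complex.norm_ofNat]
    linarith
  let g : ℂ → E := fun ζ => φ p + ζ • v
  have hg : MapsTo g (Metric.ball (0 : ℂ) 1) φ.target := by
    intro ζ hζ
    apply hball
    rw [mem_ball_iff_norm]
    simp only [g, add_sub_cancel_left, norm_smul]
    rw [mem_ball_zero_iff] at hζ
    calc ‖ζ‖ * ‖v‖ ≤ 1 * ‖v‖ := by gcongr
      _ < r := by linarith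
  have hgd : Differentiable ℂ g := by fun_prop
  have hf : IsHolomorphicDisc E (fun ζ => φ.symm (g ζ)) := by
    have h1 : MDifferentiableOn 𝓘(ℂ, E) 𝓘(ℂ, E) φ.symm φ.target :=
      mdifferentiableOn_atlas_symm (chart_mem_atlas E p)
    exact h1.comp hgd.mdifferentiable.mdifferentiableOn hg
  have h0 : (0 : ℂ) ∈ Metric.ball (0 : ℂ) 1 := by simp
  have h2 : (1 / 2 : ℂ) ∈ Metric.ball (0 : ℂ) 1 := by simp; norm_num
  have hc := DiscChain.cons (E := E) (fun ζ => φ.symm (g ζ)) 0 (1 / 2) _ 0 hf h0 h2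
    (DiscChain.nil _)
  have e0 : φ.symm (g 0) = p := by simp [g, φ.left_inv hp]
  have e2 : φ.symm (g (1 / 2)) = q := by
    have : g (1 / 2) = φ q := by
      simp [g, hv, smul_smul]
    rw [this, φ.left_inv hqs]
  simp only [e0, e2] at hc
  exact ⟨_, hc⟩

theorem exists_discChain [IsManifold 𝓘(ℂ, E) 1 X] [ConnectedSpace X] (x y : X) :
    ∃ L, DiscChain E x y L := by
  let S : Set X := {y | ∃ L, DiscChain E x y L}
  have hopen : IsOpen S := by
    rw [isOpen_iff_mem_nhds]
    rintro z ⟨L, hL⟩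
    filter_upwards [eventually_discChain (E := E) z] with w hw
    obtain ⟨M, hM⟩ := hw
    exact ⟨_, hL.trans hM⟩
  have hclosed : IsClosed S := by
    rw [← isOpen_compl_iff, isOpen_iff_mem_nhds]
    intro z hz
    filter_upwards [eventually_discChain (E := E) z] with w hw hw'
    obtain ⟨M, hM⟩ := hw
    obtain ⟨L, hL⟩ := hw'
    exact hz ⟨_, hL.trans hM.symm⟩
  have hS : S = univ := IsClopen.eq_univ ⟨hclosed, hopen⟩ ⟨x, 0, DiscChain.nil x⟩
  have : y ∈ S := hS ▸ mem_univ y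
  exact this

theorem kobayashiDist_le {x y : X} {L : ℝ} (h : DiscChain E x y L) : kobayashiDist E x y ≤ L :=
  csInf_le ⟨0, fun _ hM => DiscChain.nonneg hM⟩ h

theorem kobayashiDist_nonneg (x y : X) : 0 ≤ kobayashiDist E x y :=
  Real.sInf_nonneg fun _ hL => DiscChain.nonneg hL

theorem kobayashiDist_self (x : X) : kobayashiDist E x x = 0 :=
  le_antisymm (kobayashiDist_le (DiscChain.nil x)) (kobayashiDist_nonneg x x)

theorem kobayashiDist_comm (x y : X) : kobayashiDist E x y = kobayashiDist E y x := by
  unfold kobayashiDist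
  congr 1
  ext L
  exact ⟨DiscChain.symm, DiscChain.symm⟩

theorem kobayashiDist_triangle [IsManifold 𝓘(ℂ, E) 1 X] [ConnectedSpace X] (x y z : X) :
    kobayashiDist E x z ≤ kobayashiDist E x y + kobayashiDist E y z := by
  refine le_of_forall_pos_le_add fun ε hε => ?_
  obtain ⟨L, hL, hL'⟩ := exists_lt_of_csInf_lt (exists_discChain (E := E) x y)
    (show kobayashiDist E x y < kobayashiDist E x y + ε / 2 by linarith)
  obtain ⟨M, hM, hM'⟩ := exists_lt_of_csInf_lt (exists_discChain (E := E) y z)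
    (show kobayashiDist E y z < kobayashiDist E y z + ε / 2 by linarith)
  have := kobayashiDist_le (DiscChain.trans hL hM)
  linarith

variable (E) in
/-- The set `X` equipped with the Kobayashi distance `k_X`. -/
def KobayashiSpace (X : Type*) [TopologicalSpace X] [ChartedSpace E X] : Type _ := X

/-- The identity map from `X` to `(X, k_X)`. -/
def toKobayashiSpace (x : X) : KobayashiSpace E X := x

/-- `(X, k_X)` is a pseudometric space (a metric space exactly when `X` is hyperbolic). -/
instance [IsManifold 𝓘(ℂ, E) 1 X] [ConnectedSpace X] :
    PseudoMetricSpace (KobayashiSpace E X) where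
  dist := kobayashiDist (X := X) E
  dist_self := kobayashiDist_self (X := X) (E := E)
  dist_comm := kobayashiDist_comm (X := X) (E := E)
  dist_triangle := kobayashiDist_triangle (X := X) (E := E)

end Kobayashi

/-! ### The metric compactification -/

section MetricCompactification

variable (M : Type*) [PseudoMetricSpace M]

/-- The constant functions in `C(M)`. -/
def constantFunctions : AddSubgroup C(M, ℝ) where
  carrier := {f | ∃ c : ℝ, f = ContinuousMap.const M c}
  zero_mem' := ⟨0, rfl⟩
  add_mem' := by
    rintro _ _ ⟨c, rfl⟩ ⟨d, rfl⟩
    exact ⟨c + d, rfl⟩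
  neg_mem' := by
    rintro _ ⟨c, rfl⟩
    exact ⟨-c, rfl⟩

/-- `C_*(M)`: the quotient of `C(M)` (with the compact-open topology, that is, locally uniform
convergence for locally compact `M`) by the constants, with the quotient topology. -/
abbrev CStar : Type _ := C(M, ℝ) ⧸ constantFunctions M

variable {M} in
/-- The class of the function `d(x, ·)`. -/
def distClass (x : M) : CStar M :=
  QuotientAddGroup.mk (⟨fun z => dist x z, by fun_prop⟩ : C(M, ℝ))

/-- The metric (horofunction) compactification: the closure of `{[d(x, ·)]}` in `C_*(M)`. -/
def MetricCompactification : Type _ := closure (range (distClass (M := M)))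

instance : TopologicalSpace (MetricCompactification M) :=
  inferInstanceAs (TopologicalSpace (closure (range (distClass (M := M)))))

variable {M} in
/-- The canonical map `i_d`. -/
def metricEmbedding (x : M) : MetricCompactification M :=
  ⟨distClass x, subset_closure (mem_range_self x)⟩

end MetricCompactification

/-! ### The end compactification -/

section EndCompactification

variable {Z : Type*} [TopologicalSpace Z]

/-- An end of `Z` with respect to a compact exhaustion `(K_j)`: a decreasing sequence `(F_j)`
with `F_j` a connected component of `Z \ K_j`. -/
structure TopEnd (K : CompactExhaustion Z) where
  /-- The sequence of components. -/
  F : ℕ → Set Z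
  isComponent : ∀ j, ∃ x ∈ (K j)ᶜ, F j = connectedComponentIn (K j)ᶜ x
  decreasing : ∀ j, F (j + 1) ⊆ F j

/-- The end compactification of `Z`, as a set: the disjoint union of `Z` and its ends. -/
inductive EndCompactification (K : CompactExhaustion Z) : Type _
  | ofPoint (z : Z) : EndCompactification K
  | ofEnd (e : TopEnd K) : EndCompactification K

/-- The basic neighbourhood of an end `(F_j)`: the set `F_j` and the ends that agree with
`(F_j)` up to the index `j`. -/
def endNhd {K : CompactExhaustion Z} (e : TopEnd K) (j : ℕ) : Set (EndCompactification K) :=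
  EndCompactification.ofPoint '' e.F j ∪
    EndCompactification.ofEnd '' {f | ∀ ν ≤ j, f.F ν = e.F ν}

/-- The filter generated by the basic neighbourhoods of a point of the end compactification. -/
def endCompactificationNhds {K : CompactExhaustion Z} :
    EndCompactification K → Filter (EndCompactification K)
  | .ofPoint z => Filter.map EndCompactification.ofPoint (𝓝 z)
  | .ofEnd e => ⨅ j : ℕ, 𝓟 (endNhd e j)

instance (K : CompactExhaustion Z) : TopologicalSpace (EndCompactification K) :=
  TopologicalSpace.mkOfNhds endCompactificationNhds

end EndCompactification

/-! ### Almost-geodesics, visibility, quasi-isometric embeddings -/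

section Visibility

variable (E : Type*) [NormedAddCommGroup E] [NormedSpace ℂ E]

/-- `σ : [0, T] → X` is absolutely continuous: it is continuous, and absolutely continuous in
charts. Only the values of `σ` on `[0, T]` matter. -/
def IsAbsolutelyContinuousCurve {X : Type*} [TopologicalSpace X] [ChartedSpace E X]
    (T : ℝ) (σ : ℝ → X) : Prop :=
  ContinuousOn σ (Icc 0 T) ∧
    ∀ (p : X) (a b : ℝ), 0 ≤ a → a ≤ b → b ≤ T → MapsTo σ (Icc a b) (chartAt E p).source →
      AbsolutelyContinuousOnInterval (fun s => chartAt E p (σ s)) a b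

/-- `σ : [0, T] → X` is a `(lam, kap)`-almost-geodesic for the Kobayashi distance. The velocity
`σ'(t)` is written in the preferred chart at `σ t`. -/
structure IsAlmostGeodesic {X : Type*} [TopologicalSpace X] [ChartedSpace E X]
    (lam kap T : ℝ) (σ : ℝ → X) : Prop where
  lower : ∀ s ∈ Icc 0 T, ∀ t ∈ Icc 0 T,
    1 / lam * |s - t| - kap ≤ kobayashiDist E (σ s) (σ t)
  upper : ∀ s ∈ Icc 0 T, ∀ t ∈ Icc 0 T,
    kobayashiDist E (σ s) (σ t) ≤ lam * |s - t| + kap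
  absCont : IsAbsolutelyContinuousCurve E T σ
  speed : ∀ᵐ t ∂(volume.restrict (Icc 0 T)),
    ∃ v : E, HasDerivAt (fun s => chartAt E (σ t) (σ s)) v t ∧ kobayashiMetric E (σ t) v ≤ lam

/-- The domain `Ω ⊆ Y` has the visibility property with respect to all
`(lam, kap)`-almost-geodesics, `lam ≥ 1`, `kap > 0`: for distinct boundary points `p, q ∈ ∂Ω`,
almost-geodesics that join points near `p` to points near `q` meet a fixed compact subset
of `Ω`. -/
def HasVisibilityProperty {Y : Type*} [TopologicalSpace Y] [ChartedSpace E Y]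
    (Ω : TopologicalSpace.Opens Y) : Prop :=
  ∀ lam kap : ℝ, 1 ≤ lam → 0 < kap →
    ∀ p ∈ frontier (Ω : Set Y), ∀ q ∈ frontier (Ω : Set Y), p ≠ q →
      ∃ U ∈ 𝓝 p, ∃ V ∈ 𝓝 q, Disjoint (closure U) (closure V) ∧
        ∃ C : Set Ω, IsCompact C ∧
          ∀ (T : ℝ) (σ : ℝ → Ω), 0 ≤ T → IsAlmostGeodesic E lam kap T σ →
            (σ 0 : Y) ∈ U → (σ T : Y) ∈ V → ∃ t ∈ Icc 0 T, σ t ∈ C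

/-- `F : (X, k_X) → (X', k_X')` is a quasi-isometric embedding. -/
def IsQuasiIsometricEmbedding (E' : Type*) [NormedAddCommGroup E'] [NormedSpace ℂ E']
    {X X' : Type*} [TopologicalSpace X] [ChartedSpace E X]
    [TopologicalSpace X'] [ChartedSpace E' X'] (F : X → X') : Prop :=
  ∃ lam kap : ℝ, 1 ≤ lam ∧ 0 ≤ kap ∧ ∀ x y : X,
    1 / lam * kobayashiDist E x y - kap ≤ kobayashiDist E' (F x) (F y) ∧
      kobayashiDist E' (F x) (F y) ≤ lam * kobayashiDist E x y + kap

end Visibility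

end

/-! For a point `ξ` of the metric compactification, let `G ξ` be the filter on the closure of `Ω`
generated by the images under `F` of the traces on `X` of neighbourhoods of `ξ`. It suffices that
every `G ξ` converges to a point of the closure or to an end: a set in `G ξ` lies in `G ξ'` for all
`ξ'` near `ξ`, so the limit depends continuously on `ξ` (`continuous_of_convergesTo`). No sequences,
and no compactness of the metric compactification, are needed.

If `ξ` comes from `x` in `X`, continuity of `F` gives the limit `F x`, because the neighbourhoods of
`ξ` trace neighbourhoods of `x`. Otherwise let `h` represent `ξ`. On a large ball both `d(x, ·)` and
`d(y, ·)` have nearly the increments of `h` when `x` and `y` are near `ξ`. Along an almost shortest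
curve from `x` to `y` the first function grows and the second decreases at almost unit rate, so such
a curve cannot enter the ball (`exists_forall_curve_lt_dist`). Balls are compact by Hopf–Rinow, as
`k_X` is a complete length distance inducing the manifold topology.

The map `F` need not send curves to admissible ones, so its values on a curve are sampled at unit
steps and joined by chains of holomorphic discs parametrized by arc length. This produces
almost-geodesics of `Ω` that stay near the image of the curve, hence avoid any prescribed compact
set (`exists_forall_quasiGeodesic_avoids`). Visibility forbids such curves to join two disjoint
compact subsets of the closure. Thus `G ξ` converges to any cluster point it has, and if it has
none, it picks one component outside each `K j`, that is, an end
(`HasVisibilityProperty.exists_convergesTo`). -/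

noncomputable section

/-! ### Automorphisms of the disc -/

/-- The automorphism `ζ ↦ (ζ + a) / (1 + conj a * ζ)` of the unit disc, which maps `0` to `a`. -/
def discAut (a ζ : ℂ) : ℂ := (ζ + a) / (1 + (starRingEnd ℂ) a * ζ)

theorem one_add_conj_mul_ne_zero {a ζ : ℂ} (ha : ‖a‖ < 1) (hζ : ‖ζ‖ < 1) :
    1 + (starRingEnd ℂ) a * ζ ≠ 0 := by
  intro h
  have h1 : (starRingEnd ℂ) a * ζ = -1 := by linear_combination h
  have h2 : ‖a‖ * ‖ζ‖ = 1 := by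
    have := congrArg norm h1
    simpa using this
  nlinarith [norm_nonneg a, norm_nonneg ζ]

theorem norm_discAut_lt_one {a ζ : ℂ} (ha : ‖a‖ < 1) (hζ : ‖ζ‖ < 1) : ‖discAut a ζ‖ < 1 := by
  have h0 := one_add_conj_mul_ne_zero ha hζ
  rw [discAut, norm_div, div_lt_one (norm_pos_iff.2 h0)]
  refine lt_of_pow_lt_pow_left₀ 2 (norm_nonneg _) ?_
  have ha2 : ‖a‖ ^ 2 < 1 := by nlinarith [norm_nonneg a]
  have hz2 : ‖ζ‖ ^ 2 < 1 := by nlinarith [norm_nonneg ζ]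
  rw [Complex.sq_norm, Complex.normSq_apply] at *
  rw [Complex.sq_norm, Complex.normSq_apply]
  simp only [Complex.add_re, Complex.add_im, Complex.one_re, Complex.one_im, Complex.mul_re,
    Complex.mul_im, Complex.conj_re, Complex.conj_im]
  nlinarith [mul_pos (sub_pos.2 ha2) (sub_pos.2 hz2)]

theorem discAut_zero (a : ℂ) : discAut a 0 = a := by simp [discAut]

theorem differentiableAt_discAut {a ζ : ℂ} (ha : ‖a‖ < 1) (hζ : ‖ζ‖ < 1) :
    DifferentiableAt ℂ (discAut a) ζ := by
  unfold discAut
  exact DifferentiableAt.div (by fun_prop) (by fun_prop) (one_add_conj_mul_ne_zero ha hζ)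

theorem hasDerivAt_discAut_zero (a : ℂ) : HasDerivAt (discAut a) (1 - (starRingEnd ℂ) a * a) 0 := by
  have h1 : HasDerivAt (fun ζ : ℂ => ζ + a) 1 0 := (hasDerivAt_id _).add_const a
  have h2 : HasDerivAt (fun ζ : ℂ => 1 + (starRingEnd ℂ) a * ζ) ((starRingEnd ℂ) a) 0 := by
    simpa using ((hasDerivAt_id (0 : ℂ)).const_mul ((starRingEnd ℂ) a)).const_add 1
  exact (h1.fun_div h2 (by simp)).congr_deriv (by simp [mul_comm])

theorem discAut_sub_div {a b : ℂ} (ha : ‖a‖ < 1) (hb : ‖b‖ < 1) :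
    discAut a ((b - a) / (1 - (starRingEnd ℂ) a * b)) = b := by
  have h0 : 1 - (starRingEnd ℂ) a * b ≠ 0 := by
    have := one_add_conj_mul_ne_zero ha (ζ := -b) (by simpa using hb)
    simpa [sub_eq_add_neg] using this
  have h1 : 1 - (starRingEnd ℂ) a * a ≠ 0 := by
    have := one_add_conj_mul_ne_zero ha (ζ := -a) (by simpa using ha)
    simpa [sub_eq_add_neg] using this
  unfold discAut
  generalize (starRingEnd ℂ) a = c at h0 h1 ⊢
  have e1 : (b - a) / (1 - c * b) + a = b * ((1 - c * a) / (1 - c * b)) := by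
    rw [div_add' _ _ _ h0, ← mul_div_assoc]
    ring
  have e2 : 1 + c * ((b - a) / (1 - c * b)) = (1 - c * a) / (1 - c * b) := by
    rw [← mul_div_assoc, add_div' _ _ _ h0]
    ring
  rw [e1, e2, mul_div_assoc, div_self (div_ne_zero h1 h0), mul_one]

/-! ### The hyperbolic tangent -/

theorem Real.hasDerivAt_tanh (t : ℝ) : HasDerivAt Real.tanh (1 - Real.tanh t ^ 2) t := by
  have h0 : Real.cosh t ≠ 0 := (Real.cosh_pos t).ne'
  have e : Real.tanh = fun s => Real.sinh s / Real.cosh s := by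
    ext s
    simp [Real.tanh_eq_sinh_div_cosh]
  rw [e]
  refine ((Real.hasDerivAt_sinh t).fun_div (Real.hasDerivAt_cosh t) h0).congr_deriv ?_
  field_simp

theorem Real.contDiff_tanh {n : WithTop ℕ∞} : ContDiff ℝ n Real.tanh := by
  have e : Real.tanh = fun s => Real.sinh s / Real.cosh s := by
    ext s
    simp [Real.tanh_eq_sinh_div_cosh]
  rw [e]
  exact Real.contDiff_sinh.div Real.contDiff_cosh fun t => (Real.cosh_pos t).ne'

theorem Real.tanh_sub (s t : ℝ) :
    Real.tanh (s - t) = (Real.tanh s - Real.tanh t) / (1 - Real.tanh t * Real.tanh s) := by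
  have hs := (Real.cosh_pos s).ne'
  have ht := (Real.cosh_pos t).ne'
  have hst := (Real.cosh_pos (s - t)).ne'
  rw [Real.cosh_sub] at hst
  simp only [Real.tanh_eq_sinh_div_cosh, Real.sinh_sub, Real.cosh_sub]
  have e1 : Real.sinh s / Real.cosh s - Real.sinh t / Real.cosh t
      = (Real.sinh s * Real.cosh t - Real.cosh s * Real.sinh t) / (Real.cosh s * Real.cosh t) := by
    field_simp
  have e2 : 1 - Real.sinh t / Real.cosh t * (Real.sinh s / Real.cosh s)
      = (Real.cosh s * Real.cosh t - Real.sinh s * Real.sinh t) / (Real.cosh s * Real.cosh t) := by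
    field_simp
  rw [e1, e2]
  field_simp

theorem Real.artanh_abs_tanh (t : ℝ) : Real.artanh |Real.tanh t| = |t| := by
  rcases le_total 0 t with h | h
  · have h1 : 0 ≤ Real.tanh t := by
      rw [Real.tanh_eq_sinh_div_cosh]
      exact div_nonneg (Real.sinh_nonneg_iff.2 h) (Real.cosh_pos t).le
    rw [abs_of_nonneg h1, abs_of_nonneg h, Real.artanh_tanh]
  · have h1 : Real.tanh t ≤ 0 := by
      rw [Real.tanh_eq_sinh_div_cosh]
      exact div_nonpos_of_nonpos_of_nonneg (Real.sinh_nonpos_iff.2 h) (Real.cosh_pos t).le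
    rw [abs_of_nonpos h1, abs_of_nonpos h, ← Real.tanh_neg, Real.artanh_tanh]

/-- The hyperbolic tangent parametrizes the real diameter of the disc by Poincaré arc length; this
is the source of all curves of speed at most one below. -/
theorem poincareDist_tanh (s t : ℝ) :
    poincareDist (Real.tanh s : ℂ) (Real.tanh t : ℂ) = |s - t| := by
  rw [poincareDist, Complex.conj_ofReal, ← norm_div]
  have : ((Real.tanh s : ℂ) - Real.tanh t) / (1 - Real.tanh t * Real.tanh s)
      = ((Real.tanh (s - t) : ℝ) : ℂ) := by
    rw [Real.tanh_sub]
    push_cast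
    rfl
  rw [this, Complex.norm_real, Real.norm_eq_abs, Real.artanh_abs_tanh]

theorem norm_ofReal_tanh_lt_one (t : ℝ) : ‖(Real.tanh t : ℂ)‖ < 1 := by
  rw [Complex.norm_real, Real.norm_eq_abs, abs_lt]
  exact ⟨Real.neg_one_lt_tanh t, Real.tanh_lt_one t⟩

/-! ### Holomorphic discs in charts -/

section Discs

variable {E : Type*} [NormedAddCommGroup E] [NormedSpace ℂ E]
variable {X : Type*} [TopologicalSpace X] [ChartedSpace E X]

theorem IsHolomorphicDisc.comp {f : ℂ → X} (hf : IsHolomorphicDisc E f) {g : ℂ → ℂ}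
    (hg : ∀ ζ, ‖ζ‖ < 1 → DifferentiableAt ℂ g ζ) (hm : ∀ ζ, ‖ζ‖ < 1 → ‖g ζ‖ < 1) :
    IsHolomorphicDisc E (fun ζ => f (g ζ)) := by
  have h1 : MDifferentiableOn 𝓘(ℂ, ℂ) 𝓘(ℂ, ℂ) g (Metric.ball (0 : ℂ) 1) := by
    rw [mdifferentiableOn_iff_differentiableOn]
    exact fun ζ hζ => (hg ζ (by simpa using hζ)).differentiableWithinAt
  refine MDifferentiableOn.comp (I' := 𝓘(ℂ, ℂ)) hf h1 ?_
  intro ζ hζ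
  simpa using hm ζ (by simpa using hζ)

theorem IsHolomorphicDisc.continuousOn {f : ℂ → X} (hf : IsHolomorphicDisc E f) :
    ContinuousOn f (Metric.ball (0 : ℂ) 1) :=
  MDifferentiableOn.continuousOn hf

theorem IsHolomorphicDisc.analyticAt_chart [IsManifold 𝓘(ℂ, E) 1 X] [CompleteSpace E] {f : ℂ → X}
    (hf : IsHolomorphicDisc E f) (p : X) {ζ : ℂ} (hζ : ‖ζ‖ < 1)
    (h : f ζ ∈ (chartAt E p).source) : AnalyticAt ℂ (fun w => chartAt E p (f w)) ζ := by
  have hopen : IsOpen (Metric.ball (0 : ℂ) 1 ∩ f ⁻¹' (chartAt E p).source) :=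
    hf.continuousOn.isOpen_inter_preimage Metric.isOpen_ball (chartAt E p).open_source
  have hd : DifferentiableOn ℂ (fun w => chartAt E p (f w))
      (Metric.ball (0 : ℂ) 1 ∩ f ⁻¹' (chartAt E p).source) := by
    rw [← mdifferentiableOn_iff_differentiableOn]
    have h1 : MDifferentiableOn 𝓘(ℂ, E) 𝓘(ℂ, E) (chartAt E p) (chartAt E p).source :=
      mdifferentiableOn_atlas (chart_mem_atlas E p)
    exact h1.comp (MDifferentiableOn.mono hf inter_subset_left) fun w hw => hw.2
  exact hd.analyticAt (hopen.mem_nhds ⟨by simpa using hζ, h⟩)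

theorem IsHolomorphicDisc.mfderiv_zero {f : ℂ → X} (hf : IsHolomorphicDisc E f) :
    (mfderiv 𝓘(ℂ, ℂ) 𝓘(ℂ, E) f 0 (1 : ℂ) : E)
      = deriv (fun w => chartAt E (f 0) (f w)) 0 := by
  have h1 : MDifferentiableAt 𝓘(ℂ, ℂ) 𝓘(ℂ, E) f 0 :=
    MDifferentiableOn.mdifferentiableAt hf (Metric.ball_mem_nhds _ one_pos)
  rw [h1.mfderiv]
  simp [writtenInExtChartAt, Function.comp_def]
  rfl

theorem kobayashiMetric_le {x : X} {v : E} {α : ℝ} (hα : 0 < α) {f : ℂ → X}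
    (hf : IsHolomorphicDisc E f) (h0 : f 0 = x)
    (hv : (α : ℂ) • (mfderiv 𝓘(ℂ, ℂ) 𝓘(ℂ, E) f 0 (1 : ℂ) : E) = v) :
    kobayashiMetric E x v ≤ α :=
  csInf_le ⟨0, fun _ h => h.1.le⟩ ⟨hα, f, hf, h0, hv⟩

/-- The Kobayashi metric of the derivative of a holomorphic disc is controlled by
the Poincaré metric. -/
theorem IsHolomorphicDisc.kobayashiMetric_deriv_le [IsManifold 𝓘(ℂ, E) 1 X] [CompleteSpace E]
    {f : ℂ → X} (hf : IsHolomorphicDisc E f) {ζ : ℂ} (hζ : ‖ζ‖ < 1) :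
    kobayashiMetric E (f ζ)
      ((1 - (starRingEnd ℂ) ζ * ζ) • deriv (fun w => chartAt E (f ζ) (f w)) ζ) ≤ 1 := by
  -- Recentring the disc at `ζ` makes it a competitor with `α = 1`; the factor `1 - |ζ|²` is the
  -- derivative of the automorphism at `0`.
  have hg : IsHolomorphicDisc E (fun w => f (discAut ζ w)) :=
    hf.comp (fun w hw => differentiableAt_discAut hζ hw) (fun w hw => norm_discAut_lt_one hζ hw)
  refine kobayashiMetric_le one_pos hg (by simp [discAut_zero]) ?_
  rw [hg.mfderiv_zero]
  simp only [discAut_zero, Complex.ofReal_one]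
  have h1 : HasDerivAt (fun w => chartAt E (f ζ) (f w))
      (deriv (fun w => chartAt E (f ζ) (f w)) ζ) (discAut ζ 0) := by
    rw [discAut_zero]
    exact (hf.analyticAt_chart (f ζ) hζ (mem_chart_source E _)).differentiableAt.hasDerivAt
  exact (one_smul ℂ (_ : E)).trans (h1.scomp (0 : ℂ) (hasDerivAt_discAut_zero ζ)).deriv

end Discs

/-! ### Curves of Kobayashi speed at most one -/

section UnitSpeed

variable (E : Type*) [NormedAddCommGroup E] [NormedSpace ℂ E]
variable {X : Type*} [TopologicalSpace X] [ChartedSpace E X]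

/-- `σ : [a, b] → X` is a continuous curve that is `1`-Lipschitz for the Kobayashi distance,
Lipschitz in charts, and of Kobayashi speed at most one outside a countable set. -/
structure IsUnitSpeedCurve (σ : ℝ → X) (a b : ℝ) : Prop where
  continuousOn : ContinuousOn σ (Icc a b)
  dist_le : ∀ s ∈ Icc a b, ∀ t ∈ Icc a b, kobayashiDist E (σ s) (σ t) ≤ |s - t|
  lipschitz : ∀ (p : X) (c d : ℝ), a ≤ c → d ≤ b → MapsTo σ (Icc c d) (chartAt E p).source →
    ∃ K, LipschitzOnWith K (fun s => chartAt E p (σ s)) (Icc c d)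
  speed : ∃ N : Set ℝ, N.Countable ∧ ∀ t ∈ Ioo a b, t ∉ N →
    ∃ v : E, HasDerivAt (fun s => chartAt E (σ t) (σ s)) v t ∧ kobayashiMetric E (σ t) v ≤ 1

variable {E}

theorem kobayashiMetric_zero_le (x : X) : kobayashiMetric E x 0 ≤ 1 := by
  have hf : IsHolomorphicDisc E (fun _ : ℂ => x) := mdifferentiableOn_const
  refine kobayashiMetric_le one_pos hf rfl ?_
  rw [hf.mfderiv_zero]
  simp only [deriv_const]
  exact smul_zero (A := E) _

theorem isUnitSpeedCurve_const (x : X) (a b : ℝ) : IsUnitSpeedCurve E (fun _ => x) a b where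
  continuousOn := continuousOn_const
  dist_le s _ t _ := by
    rw [kobayashiDist_self]
    exact abs_nonneg _
  lipschitz p c d _ _ _ := ⟨0, (LipschitzWith.const _).lipschitzOnWith⟩
  speed := ⟨∅, countable_empty, fun t _ _ => ⟨0, hasDerivAt_const _ _, kobayashiMetric_zero_le x⟩⟩

/-- Since `tanh' = 1 - tanh²`, the velocity carries exactly the factor for which
`kobayashiMetric_deriv_le` bounds the Kobayashi metric by one. -/
theorem IsHolomorphicDisc.hasDerivAt_tanh [IsManifold 𝓘(ℂ, E) 1 X] [CompleteSpace E] {f : ℂ → X}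
    (hf : IsHolomorphicDisc E f) (t : ℝ) :
    HasDerivAt (fun s : ℝ => chartAt E (f (Real.tanh t : ℂ)) (f (Real.tanh s : ℂ)))
      ((1 - (starRingEnd ℂ) (Real.tanh t : ℂ) * (Real.tanh t : ℂ)) •
        deriv (fun w => chartAt E (f (Real.tanh t : ℂ)) (f w)) (Real.tanh t : ℂ)) t := by
  have h1 : HasDerivAt (fun w => chartAt E (f (Real.tanh t : ℂ)) (f w))
      (deriv (fun w => chartAt E (f (Real.tanh t : ℂ)) (f w)) (Real.tanh t : ℂ))
      (Real.tanh t : ℂ) :=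
    (hf.analyticAt_chart _ (norm_ofReal_tanh_lt_one t)
      (mem_chart_source E _)).differentiableAt.hasDerivAt
  have h2 : HasDerivAt (fun s : ℝ => (Real.tanh s : ℂ))
      (1 - (starRingEnd ℂ) (Real.tanh t : ℂ) * (Real.tanh t : ℂ)) t := by
    refine (Real.hasDerivAt_tanh t).ofReal_comp.congr_deriv ?_
    rw [Complex.conj_ofReal]
    push_cast
    ring
  exact h1.scomp t h2

theorem IsHolomorphicDisc.kobayashiDist_tanh_le {f : ℂ → X} (hf : IsHolomorphicDisc E f)
    (s t : ℝ) : kobayashiDist E (f (Real.tanh s : ℂ)) (f (Real.tanh t : ℂ)) ≤ |s - t| := by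
  rw [← poincareDist_tanh]
  have := DiscChain.cons (E := E) f (Real.tanh s) (Real.tanh t) _ 0 hf
    (by simpa using norm_ofReal_tanh_lt_one s) (by simpa using norm_ofReal_tanh_lt_one t)
    (DiscChain.nil _)
  simpa using kobayashiDist_le this

theorem IsHolomorphicDisc.isUnitSpeedCurve [IsManifold 𝓘(ℂ, E) 1 X] [CompleteSpace E] {f : ℂ → X}
    (hf : IsHolomorphicDisc E f) (a b : ℝ) :
    IsUnitSpeedCurve E (fun t => f (Real.tanh t : ℂ)) a b where
  continuousOn := by
    have h2 : Continuous fun s : ℝ => (Real.tanh s : ℂ) :=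
      Complex.continuous_ofReal.comp (Real.contDiff_tanh (n := 0)).continuous
    exact hf.continuousOn.comp h2.continuousOn fun t _ => by
      simpa using norm_ofReal_tanh_lt_one t
  dist_le s _ t _ := hf.kobayashiDist_tanh_le s t
  lipschitz p c d _ _ hm := by
    refine LocallyLipschitzOn.exists_lipschitzOnWith_of_compact isCompact_Icc ?_
    intro t ht
    have h1 : ContDiffAt ℝ 1 (fun w => chartAt E p (f w)) (Real.tanh t : ℂ) :=
      (hf.analyticAt_chart p (norm_ofReal_tanh_lt_one t) (hm ht)).contDiffAt.restrict_scalars ℝ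
    have h2 : ContDiffAt ℝ 1 (fun s : ℝ => (Real.tanh s : ℂ)) t :=
      (Complex.ofRealCLM.contDiff.comp Real.contDiff_tanh).contDiffAt
    obtain ⟨K, u, hu, hK⟩ := (ContDiffAt.comp t h1 h2).exists_lipschitzOnWith
    exact ⟨K, u, mem_nhdsWithin_of_mem_nhds hu, hK⟩
  speed := ⟨∅, countable_empty, fun t _ _ => ⟨_, hf.hasDerivAt_tanh t,
    hf.kobayashiMetric_deriv_le (norm_ofReal_tanh_lt_one t)⟩⟩

theorem IsUnitSpeedCurve.mono {σ : ℝ → X} {a b c d : ℝ} (h : IsUnitSpeedCurve E σ a b)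
    (hac : a ≤ c) (hdb : d ≤ b) : IsUnitSpeedCurve E σ c d where
  continuousOn := h.continuousOn.mono (Icc_subset_Icc hac hdb)
  dist_le s hs t ht :=
    h.dist_le s (Icc_subset_Icc hac hdb hs) t (Icc_subset_Icc hac hdb ht)
  lipschitz p c' d' h1 h2 := h.lipschitz p c' d' (hac.trans h1) (h2.trans hdb)
  speed := by
    obtain ⟨N, hN, hs⟩ := h.speed
    exact ⟨N, hN, fun t ht => hs t (Ioo_subset_Ioo hac hdb ht)⟩

theorem IsUnitSpeedCurve.congr {σ τ : ℝ → X} {a b : ℝ} (h : IsUnitSpeedCurve E σ a b)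
    (he : ∀ t ∈ Icc a b, τ t = σ t) : IsUnitSpeedCurve E τ a b where
  continuousOn := h.continuousOn.congr he
  dist_le s hs t ht := by
    rw [he s hs, he t ht]
    exact h.dist_le s hs t ht
  lipschitz p c d h1 h2 hm := by
    have he' : ∀ t ∈ Icc c d, τ t = σ t := fun t ht => he t (Icc_subset_Icc h1 h2 ht)
    obtain ⟨K, hK⟩ := h.lipschitz p c d h1 h2 (hm.congr he')
    refine ⟨K, fun s hs t ht => ?_⟩
    simpa only [he' s hs, he' t ht] using hK hs ht
  speed := by
    obtain ⟨N, hN, hs⟩ := h.speed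
    refine ⟨N, hN, fun t ht htN => ?_⟩
    obtain ⟨v, hv, hv'⟩ := hs t ht htN
    rw [he t (Ioo_subset_Icc_self ht)]
    refine ⟨v, hv.congr_of_eventuallyEq ?_, hv'⟩
    filter_upwards [isOpen_Ioo.mem_nhds ht] with s hs
    rw [he s (Ioo_subset_Icc_self hs)]

theorem IsUnitSpeedCurve.shift {σ : ℝ → X} {a b : ℝ} (h : IsUnitSpeedCurve E σ a b) (r : ℝ) :
    IsUnitSpeedCurve E (fun t => σ (t + r)) (a - r) (b - r) where
  continuousOn := h.continuousOn.comp (by fun_prop) fun t ht =>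
    ⟨by linarith [ht.1], by linarith [ht.2]⟩
  dist_le s hs t ht := by
    have := h.dist_le (s + r) ⟨by linarith [hs.1], by linarith [hs.2]⟩ (t + r)
      ⟨by linarith [ht.1], by linarith [ht.2]⟩
    rwa [add_sub_add_right_eq_sub] at this
  lipschitz p c d h1 h2 hm := by
    obtain ⟨K, hK⟩ := h.lipschitz p (c + r) (d + r) (by linarith) (by linarith) (by
      intro t ht
      have := hm (x := t - r) ⟨by linarith [ht.1], by linarith [ht.2]⟩
      simpa using this)
    refine ⟨K, fun s hs t ht => ?_⟩
    have := hK (x := s + r) ⟨by linarith [hs.1], by linarith [hs.2]⟩ (y := t + r)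
      ⟨by linarith [ht.1], by linarith [ht.2]⟩
    simpa using this
  speed := by
    obtain ⟨N, hN, hs⟩ := h.speed
    refine ⟨(fun t => t + r) ⁻¹' N, hN.preimage (add_left_injective r), fun t ht htN => ?_⟩
    obtain ⟨v, hv, hv'⟩ := hs (t + r) ⟨by linarith [ht.1], by linarith [ht.2]⟩ htN
    exact ⟨v, HasDerivAt.comp_add_const t r hv, hv'⟩

theorem lipschitzOnWith_Icc_union {V : Type*} [PseudoMetricSpace V] {f : ℝ → V} {a b c : ℝ}
    {K : NNReal} (h1 : LipschitzOnWith K f (Icc a b)) (h2 : LipschitzOnWith K f (Icc b c)) :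
    LipschitzOnWith K f (Icc a c) := by
  have key : ∀ s ∈ Icc a c, ∀ t ∈ Icc a c, s ≤ t → dist (f s) (f t) ≤ K * dist s t := by
    intro s hs t ht hst
    rcases le_total t b with htb | htb
    · exact h1.dist_le_mul s ⟨hs.1, hst.trans htb⟩ t ⟨ht.1, htb⟩
    rcases le_total s b with hsb | hsb
    · have e1 := h1.dist_le_mul s ⟨hs.1, hsb⟩ b ⟨hs.1.trans hsb, le_rfl⟩
      have e2 := h2.dist_le_mul b ⟨le_rfl, htb.trans ht.2⟩ t ⟨htb, ht.2⟩
      have e3 : dist s t = dist s b + dist b t := by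
        rw [Real.dist_eq, Real.dist_eq, Real.dist_eq, abs_of_nonpos (by linarith),
          abs_of_nonpos (by linarith), abs_of_nonpos (by linarith)]
        ring
      rw [e3, mul_add]
      exact (dist_triangle _ _ _).trans (add_le_add e1 e2)
    · exact h2.dist_le_mul s ⟨hsb, hs.2⟩ t ⟨htb, ht.2⟩
  refine LipschitzOnWith.of_dist_le_mul fun s hs t ht => ?_
  rcases le_total s t with h | h
  · exact key s hs t ht h
  · rw [dist_comm, dist_comm s]
    exact key t ht s hs h

theorem dist_toKobayashiSpace [IsManifold 𝓘(ℂ, E) 1 X] [ConnectedSpace X] (x y : X) :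
    dist (toKobayashiSpace (E := E) x) (toKobayashiSpace y) = kobayashiDist E x y := rfl

/-- The curve may have a corner at `b`, which joins the exceptional set of the speed condition; this
is why that set is allowed to be countable. -/
theorem IsUnitSpeedCurve.trans [IsManifold 𝓘(ℂ, E) 1 X] [ConnectedSpace X] {σ : ℝ → X}
    {a b c : ℝ} (hab : a ≤ b) (hbc : b ≤ c) (h1 : IsUnitSpeedCurve E σ a b)
    (h2 : IsUnitSpeedCurve E σ b c) : IsUnitSpeedCurve E σ a c where
  continuousOn := by
    rw [← Icc_union_Icc_eq_Icc hab hbc]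
    exact h1.continuousOn.union_of_isClosed h2.continuousOn isClosed_Icc isClosed_Icc
  dist_le := by
    let σ' : ℝ → KobayashiSpace E X := fun t => toKobayashiSpace (σ t)
    have e1 : LipschitzOnWith 1 σ' (Icc a b) :=
      LipschitzOnWith.of_dist_le_mul fun s hs t ht => by
        simpa [σ', Real.dist_eq, dist_toKobayashiSpace] using h1.dist_le s hs t ht
    have e2 : LipschitzOnWith 1 σ' (Icc b c) :=
      LipschitzOnWith.of_dist_le_mul fun s hs t ht => by
        simpa [σ', Real.dist_eq, dist_toKobayashiSpace] using h2.dist_le s hs t ht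
    intro s hs t ht
    simpa [σ', Real.dist_eq, dist_toKobayashiSpace] using
      (lipschitzOnWith_Icc_union e1 e2).dist_le_mul s hs t ht
  lipschitz p c' d' h1' h2' hm := by
    rcases le_total d' b with hd | hd
    · exact h1.lipschitz p c' d' h1' hd hm
    rcases le_total b c' with hc | hc
    · exact h2.lipschitz p c' d' hc h2' hm
    obtain ⟨K, hK⟩ := h1.lipschitz p c' b h1' le_rfl (hm.mono_left (Icc_subset_Icc_right hd))
    obtain ⟨L, hL⟩ := h2.lipschitz p b d' le_rfl h2' (hm.mono_left (Icc_subset_Icc_left hc))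
    exact ⟨max K L, lipschitzOnWith_Icc_union (hK.weaken (le_max_left _ _))
      (hL.weaken (le_max_right _ _))⟩
  speed := by
    obtain ⟨N, hN, hs⟩ := h1.speed
    obtain ⟨N', hN', hs'⟩ := h2.speed
    refine ⟨insert b (N ∪ N'), (hN.union hN').insert b, fun t ht htN => ?_⟩
    rw [mem_insert_iff, not_or, mem_union, not_or] at htN
    rcases lt_or_gt_of_ne htN.1 with h | h
    · exact hs t ⟨ht.1, h⟩ htN.2.1
    · exact hs' t ⟨h, ht.2⟩ htN.2.2

/-- Two curves of Kobayashi speed at most one can be concatenated. -/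
theorem IsUnitSpeedCurve.exists_concat [IsManifold 𝓘(ℂ, E) 1 X] [ConnectedSpace X] {σ τ : ℝ → X}
    {a b L : ℝ} (hab : a ≤ b) (hL : 0 ≤ L) (h1 : IsUnitSpeedCurve E σ a b)
    (h2 : IsUnitSpeedCurve E τ 0 L) (he : σ b = τ 0) :
    ∃ ρ : ℝ → X, IsUnitSpeedCurve E ρ a (b + L) ∧ (∀ t ≤ b, ρ t = σ t) ∧ ρ (b + L) = τ L := by
  refine ⟨fun t => if t ≤ b then σ t else τ (t - b), ?_, fun t ht => if_pos ht, ?_⟩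
  · refine IsUnitSpeedCurve.trans hab (by linarith) (h1.congr fun t ht => if_pos ht.2) ?_
    have := h2.shift (-b)
    rw [zero_sub, neg_neg, sub_neg_eq_add, add_comm L] at this
    refine this.congr fun t ht => ?_
    split_ifs with h
    · have : t = b := le_antisymm h ht.1
      rw [this, add_neg_cancel, he]
    · rw [sub_eq_add_neg]
  · dsimp only
    split_ifs with h
    · have : L = 0 := by linarith
      rw [this, add_zero, he]
    · rw [add_sub_cancel_left]

/-- An automorphism and a rotation `u` of the disc move `a` to `0` and `b` to the positive radius at
`‖w‖ = tanh (poincareDist a b)`, where the `tanh` parametrization applies. -/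
theorem IsHolomorphicDisc.exists_isUnitSpeedCurve [IsManifold 𝓘(ℂ, E) 1 X] [CompleteSpace E]
    {f : ℂ → X} (hf : IsHolomorphicDisc E f) {a b : ℂ} (ha : ‖a‖ < 1) (hb : ‖b‖ < 1) :
    ∃ σ : ℝ → X, IsUnitSpeedCurve E σ 0 (poincareDist a b) ∧ σ 0 = f a ∧
      σ (poincareDist a b) = f b := by
  set w : ℂ := (b - a) / (1 - (starRingEnd ℂ) a * b) with hw
  obtain ⟨u, hu, huw⟩ : ∃ u : ℂ, ‖u‖ = 1 ∧ u * (‖w‖ : ℂ) = w := by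
    rcases eq_or_ne w 0 with h | h
    · exact ⟨1, by simp, by simp [h]⟩
    · have h' : (‖w‖ : ℂ) ≠ 0 := by simpa using h
      exact ⟨w / ‖w‖, by simp [h], div_mul_cancel₀ _ h'⟩
  have hwn : ‖w‖ = ‖a - b‖ / ‖1 - (starRingEnd ℂ) b * a‖ := by
    rw [hw, norm_div, norm_sub_rev, ← Complex.norm_conj (1 - (starRingEnd ℂ) a * b)]
    simp [mul_comm]
  have hw1 : ‖w‖ < 1 := by
    have h := norm_discAut_lt_one (a := -a) (ζ := b) (by simpa using ha) hb
    have e : discAut (-a) b = w := by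
      simp [discAut, hw, sub_eq_add_neg]
    rwa [e] at h
  have hd : poincareDist a b = Real.artanh ‖w‖ := by rw [poincareDist, hwn]
  have ht : Real.tanh (poincareDist a b) = ‖w‖ := by
    rw [hd]
    exact Real.tanh_artanh ⟨by linarith [norm_nonneg w], hw1⟩
  have hnu : ∀ ζ : ℂ, ‖ζ‖ < 1 → ‖u * ζ‖ < 1 := fun ζ hζ => by rwa [norm_mul, hu, one_mul]
  have hg : IsHolomorphicDisc E (fun ζ => f (discAut a (u * ζ))) := by
    refine hf.comp (fun ζ hζ => ?_) (fun ζ hζ => norm_discAut_lt_one ha (hnu ζ hζ))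
    exact (differentiableAt_discAut ha (hnu ζ hζ)).comp ζ (by fun_prop)
  refine ⟨_, hg.isUnitSpeedCurve 0 _, by simp [discAut_zero], ?_⟩
  rw [ht, huw, hw, discAut_sub_div ha hb]

theorem DiscChain.exists_isUnitSpeedCurve [IsManifold 𝓘(ℂ, E) 1 X] [ConnectedSpace X]
    [CompleteSpace E] {x y : X} {L : ℝ} (h : DiscChain E x y L) :
    ∃ σ : ℝ → X, IsUnitSpeedCurve E σ 0 L ∧ σ 0 = x ∧ σ L = y := by
  induction h with
  | nil x => exact ⟨fun _ => x, isUnitSpeedCurve_const x 0 0, rfl, rfl⟩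
  | cons f a b y L hf ha hb h ih =>
    obtain ⟨τ, hτ, h0, hL⟩ := ih
    obtain ⟨σ, hσ, h0', hL'⟩ := hf.exists_isUnitSpeedCurve (by simpa using ha) (by simpa using hb)
    obtain ⟨ρ, hρ, hρσ, hρL⟩ := hσ.exists_concat (poincareDist_nonneg a b) h.nonneg hτ
      (hL'.trans h0.symm)
    exact ⟨ρ, hρ, by rw [hρσ 0 (poincareDist_nonneg a b), h0'], by rw [hρL, hL]⟩

/-- Points at Kobayashi distance less than `L` are joined by a curve of Kobayashi speed at most one
defined on `[0, L]`. -/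
theorem exists_isUnitSpeedCurve [IsManifold 𝓘(ℂ, E) 1 X] [ConnectedSpace X]
    [CompleteSpace E] {x y : X} {L : ℝ} (h : kobayashiDist E x y < L) :
    ∃ σ : ℝ → X, IsUnitSpeedCurve E σ 0 L ∧ σ 0 = x ∧ σ L = y := by
  obtain ⟨M, hM, hML⟩ := exists_lt_of_csInf_lt (exists_discChain (E := E) x y) h
  obtain ⟨σ, hσ, h0, hL⟩ := DiscChain.exists_isUnitSpeedCurve hM
  have hM0 : 0 ≤ M := DiscChain.nonneg hM
  -- The chain has length `M < L`; the curve waits at `y` for the remaining time, since the speed is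
  -- only bounded above.
  obtain ⟨ρ, hρ, hρσ, hρL⟩ := hσ.exists_concat hM0 (sub_nonneg.2 hML.le)
    (isUnitSpeedCurve_const y 0 (L - M)) hL
  rw [add_sub_cancel] at hρ hρL
  exact ⟨ρ, hρ, by rw [hρσ 0 hM0, h0], hρL⟩

/-- A curve of Kobayashi speed at most one with a lower distance bound is an almost-geodesic. -/
theorem IsUnitSpeedCurve.isAlmostGeodesic {σ : ℝ → X} {lam kap T : ℝ}
    (h : IsUnitSpeedCurve E σ 0 T) (hlam : 1 ≤ lam) (hkap : 0 ≤ kap)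
    (hl : ∀ s ∈ Icc 0 T, ∀ t ∈ Icc 0 T, 1 / lam * |s - t| - kap ≤ kobayashiDist E (σ s) (σ t)) :
    IsAlmostGeodesic E lam kap T σ where
  lower := hl
  upper s hs t ht := by
    have := h.dist_le s hs t ht
    nlinarith [abs_nonneg (s - t)]
  absCont := by
    refine ⟨h.continuousOn, fun p a b ha hab hb hm => ?_⟩
    obtain ⟨K, hK⟩ := h.lipschitz p a b ha hb hm
    refine LipschitzOnWith.absolutelyContinuousOnInterval (K := K) ?_
    rwa [uIcc_of_le hab]
  speed := by
    obtain ⟨N, hN, hs⟩ := h.speed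
    rw [ae_restrict_iff' measurableSet_Icc]
    -- The speed bound is known only at interior times, so the endpoints are discarded with the null
    -- set `N`.
    have h1 : ∀ᵐ t : ℝ, t ∉ N ∪ {0, T} :=
      (hN.union (Set.toFinite {0, T}).countable).ae_notMem volume
    filter_upwards [h1] with t ht htI
    rw [mem_union, not_or, mem_insert_iff, mem_singleton_iff, not_or] at ht
    obtain ⟨v, hv, hv'⟩ := hs t ⟨lt_of_le_of_ne htI.1 (Ne.symm ht.2.1),
      lt_of_le_of_ne htI.2 ht.2.2⟩ ht.1
    exact ⟨v, hv, hv'.trans hlam⟩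

end UnitSpeed

/-! ### Proper length spaces -/

theorem IsPreconnected.exists_mem_frontier {Z : Type*} [TopologicalSpace Z] {S V : Set Z}
    (hS : IsPreconnected S) {x y : Z} (hx : x ∈ S) (hxV : x ∈ V) (hy : y ∈ S) (hyV : y ∉ V) :
    ∃ w ∈ S, w ∈ frontier V := by
  by_contra! h
  have hcov : S ⊆ interior V ∪ (closure V)ᶜ := by
    intro w hw
    by_contra hc
    rw [mem_union, not_or, notMem_compl_iff] at hc
    exact h w hw ⟨hc.2, hc.1⟩
  have hx' : x ∈ interior V := (hcov hx).resolve_right fun h => h (subset_closure hxV)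
  have hy' : y ∈ (closure V)ᶜ := (hcov hy).resolve_left fun h => hyV (interior_subset h)
  obtain ⟨w, -, hw, hw'⟩ := hS _ _ isOpen_interior isClosed_closure.isOpen_compl hcov
    ⟨x, hx, hx'⟩ ⟨y, hy, hy'⟩
  exact hw' (interior_subset_closure hw)

/-- Any two points at distance less than `L` are joined by a `1`-Lipschitz curve defined on
`[0, L]`. -/
def HasLipschitzCurves (M : Type*) [PseudoMetricSpace M] : Prop :=
  ∀ (x y : M) (L : ℝ), dist x y < L → ∃ σ : ℝ → M, σ 0 = x ∧ σ L = y ∧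
    ∀ s ∈ Icc 0 L, ∀ t ∈ Icc 0 L, dist (σ s) (σ t) ≤ |s - t|

section LengthSpace

variable {M : Type*} [PseudoMetricSpace M]

/-- Take the point at time `r` on a curve from `o` to `y` defined on `[0, L]` with `r ≤ L < r + ε`.
This is the only form in which the length property enters Hopf–Rinow. -/
theorem HasLipschitzCurves.exists_dist_lt (h : HasLipschitzCurves M) {o y : M} {r ε : ℝ}
    (hr : 0 ≤ r) (hε : 0 < ε) (hy : dist o y < r + ε) : ∃ z, dist o z ≤ r ∧ dist z y < ε := by
  set L : ℝ := max r ((dist o y + (r + ε)) / 2) with hL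
  have hL1 : dist o y < L := lt_of_lt_of_le (by linarith) (le_max_right _ _)
  have hL2 : L < r + ε := max_lt (by linarith) (by linarith)
  obtain ⟨σ, h0, h1, hσ⟩ := h o y L hL1
  have hrL : r ≤ L := le_max_left _ _
  refine ⟨σ r, ?_, ?_⟩
  · have := hσ 0 ⟨le_rfl, hr.trans hrL⟩ r ⟨hr, hrL⟩
    rwa [h0, zero_sub, abs_neg, abs_of_nonneg hr] at this
  · have := hσ r ⟨hr, hrL⟩ L ⟨hr.trans hrL, le_rfl⟩
    rw [h1, abs_of_nonpos (by linarith)] at this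
    linarith

/-- The Hopf–Rinow theorem: a complete locally compact length space is proper. -/
theorem HasLipschitzCurves.properSpace (h : HasLipschitzCurves M) [CompleteSpace M]
    [LocallyCompactSpace M] : ProperSpace M := by
  refine ⟨fun o => ?_⟩
  -- The set of radii with compact closed ball is downward closed; being able to enlarge a radius
  -- and to pass to the limit from below excludes a finite supremum.
  have hopen : ∀ R, 0 ≤ R → IsCompact (Metric.closedBall o R) →
      ∃ δ > 0, IsCompact (Metric.closedBall o (R + δ)) := by
    intro R hR hc
    obtain ⟨K, hK, hKs⟩ := exists_compact_superset hc
    obtain ⟨δ, hδ, hδs⟩ := hc.exists_cthickening_subset_open isOpen_interior hKs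
    refine ⟨δ / 2, half_pos hδ, hK.of_isClosed_subset Metric.isClosed_closedBall ?_⟩
    intro y hy
    rw [Metric.mem_closedBall, dist_comm] at hy
    obtain ⟨z, hz, hzy⟩ := h.exists_dist_lt hR hδ (show dist o y < R + δ by linarith)
    refine interior_subset (hδs (Metric.thickening_subset_cthickening _ _ ?_))
    rw [Metric.mem_thickening_iff]
    exact ⟨z, by rwa [Metric.mem_closedBall, dist_comm], by rwa [dist_comm]⟩
  have hclosed : ∀ R, 0 < R → (∀ r < R, IsCompact (Metric.closedBall o r)) →
      IsCompact (Metric.closedBall o R) := by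
    intro R hR hr
    rw [isCompact_iff_totallyBounded_isComplete]
    refine ⟨?_, Metric.isClosed_closedBall.isComplete⟩
    rw [Metric.totallyBounded_iff]
    intro ε hε
    -- A slightly smaller ball is compact and within `ε / 2` of every point of the given one, so a
    -- finite `ε / 2`-net of the former is an `ε`-net of the latter.
    set r := R - min R (ε / 4) with hrdef
    have hr0 : 0 ≤ r := sub_nonneg.2 (min_le_left _ _)
    have hrR : r < R := by
      have : 0 < min R (ε / 4) := lt_min hR (by linarith)
      linarith
    have hrε : R ≤ r + ε / 4 := by
      have := min_le_right R (ε / 4)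
      linarith
    obtain ⟨t, ht, hts⟩ := Metric.totallyBounded_iff.1 (hr r hrR).totallyBounded (ε / 2)
      (half_pos hε)
    refine ⟨t, ht, fun y hy => ?_⟩
    rw [Metric.mem_closedBall, dist_comm] at hy
    obtain ⟨z, hz, hzy⟩ := h.exists_dist_lt hr0 (half_pos hε)
      (show dist o y < r + ε / 2 by linarith)
    have hz' := hts (show z ∈ Metric.closedBall o r by rwa [Metric.mem_closedBall, dist_comm])
    simp only [mem_iUnion, Metric.mem_ball] at hz' ⊢
    obtain ⟨w, hw, hzw⟩ := hz'
    refine ⟨w, hw, ?_⟩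
    have := dist_triangle y z w
    rw [dist_comm y z] at this
    linarith
  by_contra! hne
  obtain ⟨r₀, hr₀⟩ := hne
  have hmono : ∀ r R, r ≤ R → IsCompact (Metric.closedBall o R) →
      IsCompact (Metric.closedBall o r) := fun r R hrR hc =>
    hc.of_isClosed_subset Metric.isClosed_closedBall (Metric.closedBall_subset_closedBall hrR)
  set S : Set ℝ := {r | IsCompact (Metric.closedBall o r)} with hS
  have hbdd : BddAbove S := ⟨r₀, fun r hr => by
    by_contra! hlt
    exact hr₀ (hmono r₀ r hlt.le hr)⟩
  obtain ⟨r₁, hr₁, hr₁S⟩ := Metric.exists_isCompact_closedBall o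
  have hR : 0 < sSup S := lt_of_lt_of_le hr₁ (le_csSup hbdd hr₁S)
  have hRc : IsCompact (Metric.closedBall o (sSup S)) := by
    refine hclosed _ hR fun r hr => ?_
    obtain ⟨r', hr', hrr'⟩ := exists_lt_of_lt_csSup ⟨r₁, hr₁S⟩ hr
    exact hmono r r' hrr'.le hr'
  obtain ⟨δ, hδ, hc⟩ := hopen _ hR.le hRc
  have := le_csSup hbdd (show sSup S + δ ∈ S from hc)
  linarith

/-! ### Convergence to points of the metric compactification -/

/-- This makes `CStar M` Hausdorff, so that compact sets of distance classes are closed. -/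
theorem isClosed_constantFunctions : IsClosed (constantFunctions M : Set C(M, ℝ)) := by
  have : (constantFunctions M : Set C(M, ℝ)) = ⋂ z : M, ⋂ w : M, {f | f z = f w} := by
    ext f
    simp only [mem_iInter, mem_ofPred_eq]
    constructor
    · rintro ⟨c, rfl⟩ z w
      rfl
    · intro hf
      rcases isEmpty_or_nonempty M with hM | ⟨⟨o⟩⟩
      · exact ⟨0, ContinuousMap.ext fun z => hM.elim z⟩
      · exact ⟨f o, ContinuousMap.ext fun z => hf z o⟩
  rw [this]
  exact isClosed_iInter fun z => isClosed_iInter fun w =>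
    isClosed_eq (continuous_eval_const z) (continuous_eval_const w)

instance : T2Space (CStar M) :=
  haveI := isClosed_constantFunctions (M := M)
  inferInstance

theorem continuous_distClass : Continuous (distClass (M := M)) := by
  have h1 : Continuous fun x : M => (⟨fun z => dist x z, by fun_prop⟩ : C(M, ℝ)) :=
    ContinuousMap.continuous_of_continuous_uncurry _ (by
      simpa [Function.uncurry_def] using continuous_dist)
  exact QuotientAddGroup.continuous_mk.comp h1

theorem comap_metricEmbedding_nhds (ξ : MetricCompactification M) :
    comap metricEmbedding (𝓝 ξ) = comap (distClass (M := M)) (𝓝 ξ.1) := by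
  have : 𝓝 ξ = comap Subtype.val (𝓝 ξ.1) := nhds_subtype_eq_comap
  rw [this]
  exact comap_comap

theorem neBot_comap_metricEmbedding (ξ : MetricCompactification M) :
    (comap metricEmbedding (𝓝 ξ)).NeBot := by
  rw [comap_metricEmbedding_nhds, comap_neBot_iff]
  intro t ht
  obtain ⟨_, hy, x, rfl⟩ := mem_closure_iff_nhds.1 ξ.2 t ht
  exact ⟨x, hy⟩

/-- If `h` represents `ξ`, then the increments of `d(x, ·)` are uniformly close to those of `h` on
a given compact set for `x` close to `ξ`. -/
theorem eventually_abs_dist_sub_lt {ξ : MetricCompactification M} {h : C(M, ℝ)}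
    (hξ : ξ.1 = QuotientAddGroup.mk h) {B : Set M} (hB : IsCompact B) {δ : ℝ} (hδ : 0 < δ) :
    ∀ᶠ x in comap metricEmbedding (𝓝 ξ), ∀ z ∈ B, ∀ w ∈ B,
      |(dist x z - dist x w) - (h z - h w)| < δ := by
  have h1 : ∀ᶠ g in 𝓝 h, MapsTo (g - h : C(M, ℝ)) B (Metric.ball 0 (δ / 2)) := by
    have hc : Tendsto (fun g : C(M, ℝ) => g - h) (𝓝 h) (𝓝 0) := by
      have : Continuous fun g : C(M, ℝ) => g - h := by fun_prop
      simpa using this.tendsto h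
    exact hc.eventually (ContinuousMap.eventually_mapsTo hB Metric.isOpen_ball
      fun z _ => by simpa using hδ)
  have h2 : ∀ᶠ η in 𝓝 ξ.1, ∃ g : C(M, ℝ), QuotientAddGroup.mk g = η ∧
      MapsTo (g - h : C(M, ℝ)) B (Metric.ball 0 (δ / 2)) := by
    rw [hξ, QuotientAddGroup.nhds_eq, eventually_map]
    filter_upwards [h1] with g hg
    exact ⟨g, rfl, hg⟩
  rw [comap_metricEmbedding_nhds]
  filter_upwards [h2.comap distClass] with x hx z hz w hw
  obtain ⟨g, hg, hgB⟩ := hx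
  -- The representative close to `h` differs from `d(x, ·)` by a constant, which cancels in
  -- increments.
  obtain ⟨c, hc⟩ := QuotientAddGroup.eq.1 hg
  have e : ∀ v : M, dist x v = g v + c := fun v => by
    have := congrArg (fun f : C(M, ℝ) => f v) hc
    simp only [ContinuousMap.add_apply, ContinuousMap.neg_apply, ContinuousMap.coe_mk,
      ContinuousMap.const_apply] at this
    linarith
  have hz' := hgB hz
  have hw' := hgB hw
  rw [mem_ball_zero_iff, ContinuousMap.sub_apply, Real.norm_eq_abs, abs_lt] at hz' hw'
  rw [e z, e w, abs_lt]
  constructor <;> linarith [hz'.1, hz'.2, hw'.1, hw'.2]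

/-- If `y` is at distance at least `r` from `x`, some `z` in the `r`-ball around `x` lies `3r/4`
closer to `y` than `x` does. From `x` to `z` the function `d(y, ·)` drops by at least `3r/4` while
`d(x, ·)` rises by at least `3r/4`, so the two classes are not close. -/
theorem HasLipschitzCurves.comap_metricEmbedding_le [ProperSpace M] (hM : HasLipschitzCurves M)
    (x : M) : comap metricEmbedding (𝓝 (metricEmbedding x)) ≤ 𝓝 x := by
  refine Metric.nhds_basis_ball.ge_iff.2 fun r hr => ?_
  have hev := eventually_abs_dist_sub_lt (ξ := metricEmbedding x)
    (h := ⟨fun z => dist x z, by fun_prop⟩) rfl (isCompact_closedBall x r)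
    (δ := r) hr
  filter_upwards [hev] with y hy
  rw [Metric.mem_ball]
  by_contra! hle
  obtain ⟨z, hz, hzy⟩ := hM.exists_dist_lt (o := y) (y := x) (r := dist y x + r / 4 - r)
    (ε := r) (by linarith) hr (by linarith)
  have hzx : dist x z ≤ r := by rw [dist_comm]; exact hzy.le
  have h1 := hy z (by rwa [Metric.mem_closedBall, dist_comm]) x (Metric.mem_closedBall_self hr.le)
  simp only [ContinuousMap.coe_mk, dist_self, sub_zero] at h1
  have h2 := dist_triangle y z x
  rw [dist_comm z x] at h2
  rw [abs_lt] at h1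
  linarith [h1.1]

/-- The classes of points of a closed ball form a compact, hence closed, set that misses `ξ`. -/
theorem eventually_lt_dist_of_notMem_range [ProperSpace M] {ξ : MetricCompactification M}
    (hξ : ξ ∉ range (metricEmbedding (M := M))) (o : M) (R : ℝ) :
    ∀ᶠ x in comap metricEmbedding (𝓝 ξ), R < dist o x := by
  have h1 : IsCompact (distClass '' Metric.closedBall o R) :=
    (isCompact_closedBall o R).image continuous_distClass
  have h2 : ξ.1 ∉ distClass '' Metric.closedBall o R := by
    rintro ⟨x, -, hx⟩
    exact hξ ⟨x, Subtype.ext hx⟩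
  rw [comap_metricEmbedding_nhds]
  filter_upwards [preimage_mem_comap (h1.isClosed.isOpen_compl.mem_nhds h2)] with x hx
  by_contra! hle
  exact hx ⟨x, by rwa [Metric.mem_closedBall, dist_comm], rfl⟩

/-- Almost shortest curves between points close to a boundary point of the metric compactification
are far away from a given point. -/
theorem exists_forall_curve_lt_dist [ProperSpace M] {ξ : MetricCompactification M}
    (hξ : ξ ∉ range (metricEmbedding (M := M))) (o : M) (R : ℝ) :
    ∃ S ∈ comap metricEmbedding (𝓝 ξ), ∀ x ∈ S, ∀ y ∈ S, ∀ γ : ℝ → M, γ 0 = x →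
      γ (dist x y + 1) = y →
      (∀ s ∈ Icc 0 (dist x y + 1), ∀ t ∈ Icc 0 (dist x y + 1), dist (γ s) (γ t) ≤ |s - t|) →
      ∀ t ∈ Icc 0 (dist x y + 1), R < dist o (γ t) := by
  obtain ⟨h, hh⟩ := QuotientAddGroup.mk_surjective ξ.1
  refine ⟨_, (eventually_lt_dist_of_notMem_range hξ o (R + 2)).and
    (eventually_abs_dist_sub_lt hh.symm (isCompact_closedBall o (R + 2)) (δ := 1 / 2)
      (by norm_num)), ?_⟩
  rintro x ⟨hx, hxh⟩ y ⟨hy, hyh⟩ γ h0 h1 hγ t ht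
  set T := dist x y + 1 with hT
  have hT0 : 0 ≤ T := by positivity
  have hlow : ∀ s ∈ Icc 0 T, ∀ u ∈ Icc 0 T, s ≤ u →
      dist (γ s) (γ u) ≤ u - s ∧ u - s - 1 ≤ dist (γ s) (γ u) := by
    intro s hs u hu hsu
    have e1 := hγ s hs u hu
    have e2 := hγ 0 ⟨le_rfl, hT0⟩ s hs
    have e3 := hγ u hu T ⟨hT0, le_rfl⟩
    rw [h0, zero_sub, abs_neg, abs_of_nonneg hs.1] at e2
    rw [h1, abs_of_nonpos (by linarith [hu.2])] at e3
    rw [abs_of_nonpos (by linarith)] at e1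
    have e4 := dist_triangle4 x (γ s) (γ u) y
    exact ⟨by linarith, by linarith⟩
  by_contra! hle
  have hxt : dist x (γ t) ≤ t := by
    have := (hlow 0 ⟨le_rfl, hT0⟩ t ht ht.1).1
    rwa [h0, sub_zero] at this
  have hyt : dist (γ t) y ≤ T - t := by
    have := (hlow t ht T ⟨hT0, le_rfl⟩ ht.2).1
    rwa [h1] at this
  have ht2 : 2 ≤ t := by
    have := dist_triangle o (γ t) x
    rw [dist_comm (γ t) x] at this
    linarith [hx]
  have htT : t + 2 ≤ T := by
    have := dist_triangle o (γ t) y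
    linarith [hy]
  -- Compare the times `t - 2` and `t`, whose points lie in the ball of radius `R + 2`. The excess
  -- length of `γ` is `1`, so `d(x, ·)` grows by at least `1` and `d(y, ·)` decreases by at least
  -- `1`; but both increments are within `1 / 2` of the same increment of `h`.
  have hsI : t - 2 ∈ Icc 0 T := ⟨by linarith, by linarith⟩
  have a1 := hlow (t - 2) hsI t ht (by linarith)
  have a2 := hlow 0 ⟨le_rfl, hT0⟩ (t - 2) hsI (by linarith)
  have a3 := hlow 0 ⟨le_rfl, hT0⟩ t ht ht.1
  have a4 := hlow (t - 2) hsI T ⟨hT0, le_rfl⟩ (by linarith)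
  have a5 := hlow t ht T ⟨hT0, le_rfl⟩ ht.2
  rw [h0] at a2 a3
  rw [h1, dist_comm _ y] at a4 a5
  have b1 : γ (t - 2) ∈ Metric.closedBall o (R + 2) := by
    rw [Metric.mem_closedBall]
    have := dist_triangle (γ (t - 2)) (γ t) o
    rw [dist_comm (γ t) o] at this
    linarith [a1.1]
  have b2 : γ t ∈ Metric.closedBall o (R + 2) := by
    rw [Metric.mem_closedBall, dist_comm]
    linarith
  have c1 := abs_lt.1 (hxh _ b1 _ b2)
  have c2 := abs_lt.1 (hyh _ b1 _ b2)
  linarith [c1.1, c2.2, a2.1, a3.2, a4.2, a5.1]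

end LengthSpace

/-! ### The topology of the Kobayashi distance -/

section KobayashiTopology

variable {E : Type*} [NormedAddCommGroup E] [NormedSpace ℂ E]
variable {X : Type*} [TopologicalSpace X] [ChartedSpace E X] [IsManifold 𝓘(ℂ, E) 1 X]

/-- An affine disc in the chart reaches `q` at the parameter `tanh (ε / 2)`, at Poincaré distance `ε
/ 2` from the centre, and stays in the chart if `q` is close to `p`. -/
theorem eventually_kobayashiDist_lt (p : X) {ε : ℝ} (hε : 0 < ε) :
    ∀ᶠ q in 𝓝 p, kobayashiDist E p q < ε := by
  set φ := chartAt E p with hφ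
  have hp : p ∈ φ.source := mem_chart_source E p
  obtain ⟨r, hr, hball⟩ := Metric.isOpen_iff.1 φ.open_target (φ p) (φ.map_source hp)
  set τ : ℝ := Real.tanh (ε / 2) with hτ
  have hτ0 : 0 < τ := by
    rw [hτ, Real.tanh_eq_sinh_div_cosh]
    exact div_pos (Real.sinh_pos_iff.2 (half_pos hε)) (Real.cosh_pos _)
  have hτc : (τ : ℂ) ≠ 0 := by exact_mod_cast hτ0.ne'
  have hnear : ∀ᶠ q in 𝓝 p, φ q ∈ Metric.ball (φ p) (τ * r) :=
    (φ.continuousAt hp).eventually (Metric.ball_mem_nhds _ (mul_pos hτ0 hr))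
  filter_upwards [hnear, φ.open_source.mem_nhds hp] with q hq hqs
  set v : E := (τ : ℂ)⁻¹ • (φ q - φ p) with hv
  have hvn : ‖v‖ < r := by
    rw [hv, norm_smul, norm_inv, Complex.norm_real, Real.norm_eq_abs, abs_of_pos hτ0]
    rw [mem_ball_iff_norm] at hq
    rwa [inv_mul_lt_iff₀ hτ0]
  let g : ℂ → E := fun ζ => φ p + ζ • v
  have hg : MapsTo g (Metric.ball (0 : ℂ) 1) φ.target := by
    intro ζ hζ
    apply hball
    rw [mem_ball_iff_norm]
    simp only [g, add_sub_cancel_left, norm_smul]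
    rw [mem_ball_zero_iff] at hζ
    calc ‖ζ‖ * ‖v‖ ≤ 1 * ‖v‖ := by gcongr
      _ < r := by linarith
  have hgd : Differentiable ℂ g := by fun_prop
  have hf : IsHolomorphicDisc E (fun ζ => φ.symm (g ζ)) := by
    have h1 : MDifferentiableOn 𝓘(ℂ, E) 𝓘(ℂ, E) φ.symm φ.target :=
      mdifferentiableOn_atlas_symm (chart_mem_atlas E p)
    exact h1.comp hgd.mdifferentiable.mdifferentiableOn hg
  have hc := hf.kobayashiDist_tanh_le 0 (ε / 2)
  have e0 : φ.symm (g ((Real.tanh 0 : ℝ) : ℂ)) = p := by simp [g, φ.left_inv hp]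
  have e2 : φ.symm (g ((Real.tanh (ε / 2) : ℝ) : ℂ)) = q := by
    have : g (τ : ℂ) = φ q := by
      simp [g, hv, smul_smul, hτc]
    rw [← hτ, this, φ.left_inv hqs]
  rw [e0, e2, zero_sub, abs_neg, abs_of_pos (half_pos hε)] at hc
  linarith

variable [ConnectedSpace X]

theorem continuous_toKobayashiSpace :
    Continuous (toKobayashiSpace : X → KobayashiSpace E X) := by
  rw [continuous_iff_continuousAt]
  intro p
  rw [ContinuousAt, Metric.tendsto_nhds]
  intro ε hε
  filter_upwards [eventually_kobayashiDist_lt (E := E) p hε] with q hq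
  rwa [dist_comm, dist_toKobayashiSpace]

variable (X) in
theorem hasLipschitzCurves_kobayashiSpace [CompleteSpace E] :
    HasLipschitzCurves (KobayashiSpace E X) := by
  intro x y L h
  obtain ⟨σ, hσ, h0, h1⟩ := exists_isUnitSpeedCurve (E := E) (X := X) (x := x) (y := y) h
  exact ⟨fun t => toKobayashiSpace (σ t), h0, h1, hσ.dist_le⟩

/-- Barth's argument: a curve from `x` that leaves a relatively compact neighbourhood crosses its
compact frontier, on which the distance to `x` has a positive minimum by hyperbolicity. -/
theorem IsKobayashiHyperbolic.exists_forall_dist_lt_mem [CompleteSpace E] [T2Space X]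
    [LocallyCompactSpace X] (hX : IsKobayashiHyperbolic E X) (x : X) {U : Set X} (hU : U ∈ 𝓝 x) :
    ∃ m > 0, ∀ y, kobayashiDist E x y < m → y ∈ U := by
  obtain ⟨K, hKx, hKU, hK⟩ := local_compact_nhds hU
  have hx : x ∈ interior K := mem_interior_iff_mem_nhds.2 hKx
  have hfr : IsCompact (frontier (interior K)) := by
    refine hK.of_isClosed_subset isClosed_frontier ?_
    exact frontier_subset_closure.trans (closure_minimal interior_subset hK.isClosed)
  have hcont : Continuous fun w : X => kobayashiDist E x w := by
    have h : Continuous fun w : X => dist (toKobayashiSpace (E := E) x) (toKobayashiSpace w) :=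
      continuous_const.dist continuous_toKobayashiSpace
    exact h
  have hmin : ∃ m > 0, ∀ w ∈ frontier (interior K), m ≤ kobayashiDist E x w := by
    rcases (frontier (interior K)).eq_empty_or_nonempty with he | hne
    · exact ⟨1, one_pos, fun w hw => by simp [he] at hw⟩
    · obtain ⟨w₀, hw₀, hmin⟩ := hfr.exists_isMinOn hne hcont.continuousOn
      refine ⟨kobayashiDist E x w₀, ?_, fun w hw => hmin hw⟩
      refine lt_of_le_of_ne (kobayashiDist_nonneg _ _) fun h0 => ?_
      have := hX x w₀ h0.symm
      rw [← this, isOpen_interior.frontier_eq] at hw₀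
      exact hw₀.2 hx
  obtain ⟨m, hm, hmw⟩ := hmin
  refine ⟨m, hm, fun y hy => hKU (interior_subset ?_)⟩
  by_contra hyK
  obtain ⟨L, hL1, hL2⟩ := exists_between hy
  have hL0 : 0 ≤ L := (kobayashiDist_nonneg _ _).trans hL1.le
  obtain ⟨σ, hσ, h0, h1⟩ := exists_isUnitSpeedCurve hL1
  have hpre : IsPreconnected (σ '' Icc 0 L) := isPreconnected_Icc.image _ hσ.continuousOn
  obtain ⟨_, ⟨t, ht, rfl⟩, hw⟩ := hpre.exists_mem_frontier (V := interior K)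
    ⟨0, ⟨le_rfl, hL0⟩, h0⟩ hx ⟨L, ⟨hL0, le_rfl⟩, h1⟩ hyK
  have h2 := hσ.dist_le 0 ⟨le_rfl, hL0⟩ t ht
  rw [h0, zero_sub, abs_neg, abs_of_nonneg ht.1] at h2
  linarith [hmw _ hw, ht.2]

/-- The identity map from `(X, k_X)` to `X`. -/
def ofKobayashiSpace (x : KobayashiSpace E X) : X := x

/-- The Kobayashi distance of a hyperbolic manifold induces the manifold topology. -/
def IsKobayashiHyperbolic.homeomorph [CompleteSpace E] [T2Space X] [LocallyCompactSpace X]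
    (hX : IsKobayashiHyperbolic E X) : X ≃ₜ KobayashiSpace E X where
  toFun := toKobayashiSpace
  invFun := ofKobayashiSpace
  left_inv _ := rfl
  right_inv _ := rfl
  continuous_toFun := continuous_toKobayashiSpace
  continuous_invFun := by
    refine continuous_iff_continuousAt.2 fun x U hU => ?_
    obtain ⟨m, hm, h⟩ := hX.exists_forall_dist_lt_mem (ofKobayashiSpace x) hU
    refine mem_of_superset (Metric.ball_mem_nhds x hm) fun y hy =>
      h (ofKobayashiSpace (E := E) y) (lt_of_eq_of_lt (kobayashiDist_comm (X := X) _ _) hy)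

theorem IsKobayashiHyperbolic.properSpace [CompleteSpace E] [T2Space X] [LocallyCompactSpace X]
    (hX : IsKobayashiHyperbolic E X) [CompleteSpace (KobayashiSpace E X)] :
    ProperSpace (KobayashiSpace E X) :=
  haveI : LocallyCompactSpace (KobayashiSpace E X) :=
    hX.homeomorph.symm.isClosedEmbedding.locallyCompactSpace
  (hasLipschitzCurves_kobayashiSpace X).properSpace

end KobayashiTopology

/-! ### Quasi-geodesics of Kobayashi speed at most one -/

section QuasiGeodesic

variable {E : Type*} [NormedAddCommGroup E] [NormedSpace ℂ E]
variable {X : Type*} [TopologicalSpace X] [ChartedSpace E X]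

variable (E) in
/-- A `(lam, kap)`-quasi-geodesic defined on `[a, b]` of Kobayashi speed at most one. -/
structure IsUnitSpeedQuasiGeodesic (lam kap : ℝ) (σ : ℝ → X) (a b : ℝ) : Prop extends
    IsUnitSpeedCurve E σ a b where
  lower : ∀ s ∈ Icc a b, ∀ t ∈ Icc a b, 1 / lam * |s - t| - kap ≤ kobayashiDist E (σ s) (σ t)

theorem IsUnitSpeedQuasiGeodesic.mono {lam kap : ℝ} {σ : ℝ → X} {a b c d : ℝ}
    (h : IsUnitSpeedQuasiGeodesic E lam kap σ a b) (hac : a ≤ c) (hdb : d ≤ b) :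
    IsUnitSpeedQuasiGeodesic E lam kap σ c d where
  toIsUnitSpeedCurve := h.toIsUnitSpeedCurve.mono hac hdb
  lower s hs t ht := h.lower s (Icc_subset_Icc hac hdb hs) t (Icc_subset_Icc hac hdb ht)

theorem IsUnitSpeedQuasiGeodesic.isAlmostGeodesic {lam kap : ℝ} {σ : ℝ → X} {a b : ℝ}
    (h : IsUnitSpeedQuasiGeodesic E lam kap σ a b) (hlam : 1 ≤ lam) (hkap : 0 ≤ kap) :
    IsAlmostGeodesic E lam kap (b - a) (fun t => σ (t + a)) := by
  have h1 := h.toIsUnitSpeedCurve.shift a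
  rw [sub_self] at h1
  refine h1.isAlmostGeodesic hlam hkap fun s hs t ht => ?_
  have := h.lower (s + a) ⟨by linarith [hs.1], by linarith [hs.2]⟩ (t + a)
    ⟨by linarith [ht.1], by linarith [ht.2]⟩
  rwa [add_sub_add_right_eq_sub] at this

variable [IsManifold 𝓘(ℂ, E) 1 X] [ConnectedSpace X] [CompleteSpace E]

theorem exists_isUnitSpeedCurve_through {z : ℕ → X} {L : ℝ} (hL : 0 ≤ L)
    (hz : ∀ i, kobayashiDist E (z i) (z (i + 1)) < L) (m : ℕ) :
    ∃ σ : ℝ → X, IsUnitSpeedCurve E σ 0 (m * L) ∧ ∀ i ≤ m, σ (i * L) = z i := by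
  induction m with
  | zero =>
    refine ⟨fun _ => z 0, isUnitSpeedCurve_const _ _ _, fun i hi => ?_⟩
    rw [Nat.le_zero.1 hi]
  | succ m ih =>
    obtain ⟨σ, hσ, hi⟩ := ih
    obtain ⟨τ, hτ, h0, h1⟩ := exists_isUnitSpeedCurve (hz m)
    obtain ⟨ρ, hρ, hρσ, hρL⟩ := hσ.exists_concat (by positivity) hL hτ
      ((hi m le_rfl).trans h0.symm)
    have e : ((m + 1 : ℕ) : ℝ) * L = m * L + L := by push_cast; ring
    refine ⟨ρ, by rwa [e], fun i hle => ?_⟩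
    rcases Nat.lt_or_ge m i with h | h
    · rw [show i = m + 1 by omega, e, hρL, h1]
    · rw [hρσ _ (by gcongr), hi i h]

/-- A discrete quasi-geodesic is followed by a quasi-geodesic of Kobayashi speed at most one. -/
theorem exists_isUnitSpeedQuasiGeodesic {z : ℕ → X} {L lam c : ℝ} (hL : 0 < L) (hlam : 1 ≤ lam)
    (m : ℕ) (hz : ∀ i, kobayashiDist E (z i) (z (i + 1)) < L)
    (hz' : ∀ i ≤ m, ∀ j ≤ m, 1 / lam * |(i : ℝ) - j| - c ≤ kobayashiDist E (z i) (z j)) :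
    ∃ σ : ℝ → X, IsUnitSpeedQuasiGeodesic E (lam * L) (c + 1 + 2 * L) σ 0 (m * L) ∧ σ 0 = z 0 ∧
      σ (m * L) = z m ∧ ∀ t ∈ Icc 0 (m * L), ∃ i ≤ m, kobayashiDist E (z i) (σ t) ≤ L := by
  obtain ⟨σ, hσ, hi⟩ := exists_isUnitSpeedCurve_through (E := E) hL.le hz m
  have hnear : ∀ t ∈ Icc 0 (m * L), ∃ i ≤ m, (i : ℝ) * L ≤ t ∧ t ≤ i * L + L ∧
      kobayashiDist E (z i) (σ t) ≤ L := by
    intro t ht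
    have h1 := Nat.floor_le (div_nonneg ht.1 hL.le)
    have h2 := (Nat.lt_floor_add_one (t / L)).le
    rw [le_div_iff₀ hL] at h1
    rw [div_le_iff₀ hL, add_mul, one_mul] at h2
    have h3 : ⌊t / L⌋₊ ≤ m := Nat.floor_le_of_le (by rw [div_le_iff₀ hL]; exact ht.2)
    refine ⟨⌊t / L⌋₊, h3, h1, h2, ?_⟩
    have h4 := hσ.dist_le (⌊t / L⌋₊ * L) ⟨by positivity, h1.trans ht.2⟩ t ht
    rw [hi _ h3, abs_of_nonpos (by linarith)] at h4
    linarith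
  refine ⟨σ, ⟨hσ, fun s hs t ht => ?_⟩, ?_, hi m le_rfl, fun t ht => ?_⟩
  · obtain ⟨i, him, hi1, hi2, hi3⟩ := hnear s hs
    obtain ⟨j, hjm, hj1, hj2, hj3⟩ := hnear t ht
    have h1 := hz' i him j hjm
    have h2 := kobayashiDist_triangle (E := E) (z i) (σ s) (z j)
    have h3 := kobayashiDist_triangle (E := E) (σ s) (σ t) (z j)
    rw [kobayashiDist_comm (σ t)] at h3
    have h4 : |s - t| ≤ |(i : ℝ) - j| * L + L := by
      rw [← abs_of_pos hL, ← abs_mul, abs_of_pos hL]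
      have := abs_le.1 (le_refl |((i : ℝ) - j) * L|)
      rw [abs_le]
      constructor <;> linarith [this.1, this.2]
    -- Rounding the times to multiples of `L` costs the `1`, and replacing `σ s`, `σ t` by `z i`, `z
    -- j` costs the `2 * L` of the additive constant.
    have h5 : 1 / (lam * L) * |s - t| ≤ 1 / lam * |(i : ℝ) - j| + 1 := by
      have hl0 : 0 < lam := by linarith
      calc 1 / (lam * L) * |s - t| ≤ 1 / (lam * L) * (|(i : ℝ) - j| * L + L) := by gcongr
        _ = 1 / lam * |(i : ℝ) - j| + 1 / lam := by field_simp
        _ ≤ 1 / lam * |(i : ℝ) - j| + 1 := by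
          gcongr
          rw [div_le_one hl0]
          exact hlam
    linarith
  · simpa using hi 0 m.zero_le
  · obtain ⟨i, him, -, -, h⟩ := hnear t ht
    exact ⟨i, him, h⟩

end QuasiGeodesic

/-- The image under a quasi-isometric embedding of an almost shortest curve is followed by a
quasi-geodesic of Kobayashi speed at most one. -/
theorem exists_isUnitSpeedQuasiGeodesic_of_curve
    {M : Type*} [PseudoMetricSpace M]
    {E' : Type*} [NormedAddCommGroup E'] [NormedSpace ℂ E'] [CompleteSpace E']
    {X' : Type*} [TopologicalSpace X'] [ChartedSpace E' X'] [IsManifold 𝓘(ℂ, E') 1 X']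
    [ConnectedSpace X'] {F : M → X'} {lam kap : ℝ} (hlam : 1 ≤ lam) (hkap : 0 ≤ kap)
    (hF : ∀ x y : M, 1 / lam * dist x y - kap ≤ kobayashiDist E' (F x) (F y) ∧
      kobayashiDist E' (F x) (F y) ≤ lam * dist x y + kap)
    {x y : M} {γ : ℝ → M} (h0 : γ 0 = x) (h1 : γ (dist x y + 1) = y)
    (hγ : ∀ s ∈ Icc 0 (dist x y + 1), ∀ t ∈ Icc 0 (dist x y + 1), dist (γ s) (γ t) ≤ |s - t|) :
    ∃ (σ : ℝ → X') (T : ℝ), 0 ≤ T ∧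
      IsUnitSpeedQuasiGeodesic E' (lam * (lam + kap + 1)) (2 + kap + 1 + 2 * (lam + kap + 1)) σ 0 T ∧
      σ 0 = F x ∧ σ T = F y ∧ ∀ t ∈ Icc 0 T, ∃ u ∈ Icc 0 (dist x y + 1),
        kobayashiDist E' (F (γ u)) (σ t) ≤ lam + kap + 1 := by
  set T := dist x y + 1 with hT
  have hT0 : 0 ≤ T := by positivity
  have hlow : ∀ s ∈ Icc 0 T, ∀ u ∈ Icc 0 T, |s - u| - 1 ≤ dist (γ s) (γ u) := by
    have key : ∀ s ∈ Icc 0 T, ∀ u ∈ Icc 0 T, s ≤ u → u - s - 1 ≤ dist (γ s) (γ u) := by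
      intro s hs u hu hsu
      have e2 := hγ 0 ⟨le_rfl, hT0⟩ s hs
      have e3 := hγ u hu T ⟨hT0, le_rfl⟩
      rw [h0, zero_sub, abs_neg, abs_of_nonneg hs.1] at e2
      rw [h1, abs_of_nonpos (by linarith [hu.2])] at e3
      have e4 := dist_triangle4 x (γ s) (γ u) y
      linarith
    intro s hs u hu
    rcases le_total s u with h | h
    · rw [abs_of_nonpos (by linarith), neg_sub]
      exact key s hs u hu h
    · rw [abs_of_nonneg (by linarith), dist_comm]
      exact key u hu s hs h
  set m : ℕ := ⌈T⌉₊ with hm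
  have hmT : T ≤ m := Nat.le_ceil T
  have hmT' : (m : ℝ) < T + 1 := Nat.ceil_lt_add_one hT0
  -- Integer times truncated at `T`: consecutive ones differ by at most `1`, and truncation shifts
  -- the indices up to `m = ⌈T⌉` by at most `1`. This shift and the excess length `1` of `γ` give
  -- the `2` in the additive constant.
  let c : ℕ → ℝ := fun i => min (i : ℝ) T
  have hc : ∀ i, c i ∈ Icc 0 T := fun i => ⟨le_min (Nat.cast_nonneg i) hT0, min_le_right _ _⟩
  have hz : ∀ i, kobayashiDist E' (F (γ (c i))) (F (γ (c (i + 1)))) < lam + kap + 1 := by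
    intro i
    have e1 := hγ _ (hc i) _ (hc (i + 1))
    have e2 : |c i - c (i + 1)| ≤ 1 := by
      refine (abs_min_sub_min_le_max _ _ _ _).trans ?_
      simp
    have e3 := (hF (γ (c i)) (γ (c (i + 1)))).2
    nlinarith
  have hz' : ∀ i ≤ m, ∀ j ≤ m, 1 / lam * |(i : ℝ) - j| - (2 + kap)
      ≤ kobayashiDist E' (F (γ (c i))) (F (γ (c j))) := by
    intro i hi j hj
    have e1 := hlow _ (hc i) _ (hc j)
    have e3 := (hF (γ (c i)) (γ (c j))).1
    have hnear : ∀ k ≤ m, (k : ℝ) - 1 ≤ c k ∧ c k ≤ k := fun k hk => by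
      have : (k : ℝ) ≤ m := by exact_mod_cast hk
      exact ⟨le_min (by linarith) (by linarith), min_le_left _ _⟩
    have e2 : |(i : ℝ) - j| ≤ |c i - c j| + 1 := by
      have := abs_le.1 (le_refl |c i - c j|)
      rw [abs_le]
      constructor <;> linarith [this.1, this.2, (hnear i hi).1, (hnear i hi).2, (hnear j hj).1,
        (hnear j hj).2]
    have hl0 : 0 < lam := by linarith
    have hl1 : 1 / lam ≤ 1 := by rwa [div_le_one hl0]
    have hl2 : 0 < 1 / lam := by positivity
    have e4 : 1 / lam * |(i : ℝ) - j| ≤ 1 / lam * (dist (γ (c i)) (γ (c j)) + 2) := by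
      gcongr
      linarith
    linarith
  obtain ⟨σ, hσ, hσ0, hσ1, hσn⟩ := exists_isUnitSpeedQuasiGeodesic (E := E')
    (z := fun i => F (γ (c i))) (L := lam + kap + 1) (by linarith) hlam m hz hz'
  refine ⟨σ, m * (lam + kap + 1), mul_nonneg (Nat.cast_nonneg m) (by linarith), hσ, ?_, ?_,
    fun t ht => ?_⟩
  · rw [hσ0]
    have : c 0 = 0 := by simp [c, hT0]
    rw [this, h0]
  · rw [hσ1]
    have : c m = T := min_eq_right hmT
    rw [this, h1]
  · obtain ⟨i, -, hi⟩ := hσn t ht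
    exact ⟨c i, hc i, hi⟩

/-! ### Convergence in the end compactification -/

section Ends

variable {Z : Type*} [TopologicalSpace Z] {K : CompactExhaustion Z}

/-- A filter on `Z` converges to a point of `Z`, or to an end. -/
def ConvergesTo (l : Filter Z) : EndCompactification K → Prop
  | .ofPoint z => l ≤ 𝓝 z
  | .ofEnd e => ∀ j, e.F j ∈ l

theorem TopEnd.subset_compl (e : TopEnd K) (j : ℕ) : e.F j ⊆ (K j)ᶜ := by
  obtain ⟨x, -, hx⟩ := e.isComponent j
  rw [hx]
  exact connectedComponentIn_subset _ _

theorem TopEnd.isPreconnected (e : TopEnd K) (j : ℕ) : IsPreconnected (e.F j) := by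
  obtain ⟨x, -, hx⟩ := e.isComponent j
  rw [hx]
  exact isPreconnected_connectedComponentIn

theorem TopEnd.eq_connectedComponentIn (e : TopEnd K) {j : ℕ} {z : Z} (hz : z ∈ e.F j) :
    e.F j = connectedComponentIn (K j)ᶜ z := by
  obtain ⟨x, -, hx⟩ := e.isComponent j
  rw [hx] at hz ⊢
  exact connectedComponentIn_eq hz

theorem TopEnd.antitone (e : TopEnd K) : Antitone e.F := antitone_nat_of_succ_le e.decreasing

/-- A compact set is contained in some `K j`, which `e.F j` avoids. This separates ends from points.
-/
theorem TopEnd.not_mem_of_isCompact (e : TopEnd K) {l : Filter Z} [l.NeBot]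
    (h : ∀ j, e.F j ∈ l) {C : Set Z} (hC : IsCompact C) : C ∉ l := by
  intro hl
  obtain ⟨j, hj⟩ := K.exists_superset_of_isCompact hC
  obtain ⟨z, hz, hz'⟩ := Filter.nonempty_of_mem (inter_mem hl (h j))
  exact e.subset_compl j hz' (hj hz)

theorem ConvergesTo.eq_of_le_nhds [T2Space Z] {l : Filter Z} [l.NeBot] {a : EndCompactification K}
    (h : ConvergesTo l a) {z : Z} (hz : l ≤ 𝓝 z) : a = .ofPoint z := by
  cases a with
  | ofPoint w => rw [tendsto_nhds_unique (f := id) (show Tendsto id l (𝓝 w) from h) hz]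
  | ofEnd e =>
    obtain ⟨j, hj⟩ := K.exists_mem_nhds z
    exact absurd (hz hj) (e.not_mem_of_isCompact h (K.isCompact j))

/-- A map to the end compactification that is given by limits of filters which depend
semicontinuously on a parameter is continuous. -/
theorem continuous_of_convergesTo [T2Space Z] [LocallyCompactSpace Z] {W : Type*}
    [TopologicalSpace W] {G : W → Filter Z} (hne : ∀ w, (G w).NeBot)
    (hG : ∀ w, ∀ S ∈ G w, ∀ᶠ w' in 𝓝 w, S ∈ G w') {f : W → EndCompactification K}
    (hf : ∀ w, ConvergesTo (G w) (f w)) : Continuous f := by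
  have key : ∀ w, Tendsto f (𝓝 w) (endCompactificationNhds (f w)) := by
    intro w
    have hw := hf w
    cases hfw : f w with
    | ofPoint z =>
      rw [hfw] at hw
      intro U hU
      -- A filter containing `N` has its point limits in `N`, which is closed, and cannot converge
      -- to an end, as `N` is compact.
      obtain ⟨N, hNz, hNU, hN⟩ := local_compact_nhds (show _ ∈ 𝓝 z from hU)
      rw [mem_map]
      filter_upwards [hG w N (hw hNz)] with w' hw'
      have hc := hf w'
      have hne' := hne w'
      cases hfw' : f w' with
      | ofPoint z' =>
        rw [hfw'] at hc
        have hz' : z' ∈ N := by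
          rw [← hN.isClosed.closure_eq]
          exact mem_closure_of_tendsto (f := id) (show Tendsto id (G w') (𝓝 z') from hc) hw'
        have := hNU hz'
        rw [mem_preimage, hfw']
        exact this
      | ofEnd e =>
        rw [hfw'] at hc
        exact absurd hw' (e.not_mem_of_isCompact hc hN)
    | ofEnd e =>
      rw [hfw] at hw
      refine tendsto_iInf.2 fun j => tendsto_principal.2 ?_
      -- The index `j + 1` is used because a limit point only lies in the closure of the component;
      -- the closure of `e.F (j + 1)` still avoids `K j` and so lies in `e.F j`.
      filter_upwards [hG w _ (hw (j + 1))] with w' hw'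
      have hc := hf w'
      have hne' := hne w'
      cases hfw' : f w' with
      | ofPoint z' =>
        rw [hfw'] at hc
        refine Or.inl ⟨z', ?_, rfl⟩
        have hz' : z' ∈ closure (e.F (j + 1)) :=
          mem_closure_of_tendsto (f := id) (show Tendsto id (G w') (𝓝 z') from hc) hw'
        have hzK : z' ∉ K j := by
          intro hz
          obtain ⟨y, hy, hy'⟩ := mem_closure_iff.1 hz' _ isOpen_interior
            (K.subset_interior_succ j hz)
          exact e.subset_compl _ hy' (interior_subset hy)
        obtain ⟨y, hy⟩ := Filter.nonempty_of_mem hw'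
        have hpre : IsPreconnected (insert z' (e.F (j + 1))) :=
          (e.isPreconnected (j + 1)).subset_closure (subset_insert _ _)
            (insert_subset hz' subset_closure)
        rw [e.eq_connectedComponentIn (e.decreasing j hy)]
        refine hpre.subset_connectedComponentIn (mem_insert_of_mem _ hy) ?_ (mem_insert _ _)
        exact insert_subset hzK ((e.decreasing j).trans (e.subset_compl j))
      | ofEnd e' =>
        rw [hfw'] at hc
        refine Or.inr ⟨e', fun ν hν => ?_, rfl⟩
        obtain ⟨y, hy, hy'⟩ := Filter.nonempty_of_mem (inter_mem hw' (hc ν))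
        rw [e'.eq_connectedComponentIn hy',
          e.eq_connectedComponentIn (e.antitone (hν.trans j.le_succ) hy)]
  -- Open sets are by definition those that belong to the prescribed filter at each of their points,
  -- so the actual neighbourhood filters need not be identified.
  refine continuous_def.2 fun U hU => isOpen_iff_mem_nhds.2 fun w hw => ?_
  exact key w (hU (f w) hw)

end Ends

/-! ### Consequences of visibility -/

section Visibility

variable {E : Type*} [NormedAddCommGroup E] [NormedSpace ℂ E]
variable {Y : Type*} [TopologicalSpace Y] [ChartedSpace E Y] {Ω : TopologicalSpace.Opens Y}

/-- The inclusion of a domain into its closure. -/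
def toClosure (x : Ω) : closure (Ω : Set Y) := ⟨x, subset_closure x.2⟩

theorem isOpenEmbedding_toClosure : Topology.IsOpenEmbedding (toClosure (Ω := Ω)) := by
  have h1 : Topology.IsEmbedding (toClosure (Ω := Ω)) :=
    Topology.IsEmbedding.inclusion subset_closure
  refine ⟨h1, ?_⟩
  have : range (toClosure (Ω := Ω)) = Subtype.val ⁻¹' (Ω : Set Y) := by
    ext z
    exact ⟨fun ⟨x, hx⟩ => hx ▸ x.2, fun hz => ⟨⟨z, hz⟩, rfl⟩⟩
  rw [this]
  exact Ω.isOpen.preimage continuous_subtype_val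

/-- In a visibility domain, the quasi-geodesics that join two disjoint compact subsets of the
closure meet a fixed compact subset of the domain. -/
theorem HasVisibilityProperty.exists_isCompact [LocallyCompactSpace Ω]
    (hΩ : HasVisibilityProperty E Ω) {lam kap : ℝ} (hlam : 1 ≤ lam) (hkap : 0 < kap)
    {A B : Set (closure (Ω : Set Y))} (hA : IsCompact A) (hB : IsCompact B) (hAB : Disjoint A B) :
    ∃ C : Set Ω, IsCompact C ∧ ∀ (σ : ℝ → Ω) (a b : ℝ), a ≤ b →
      IsUnitSpeedQuasiGeodesic E lam kap σ a b → toClosure (σ a) ∈ A → toClosure (σ b) ∈ B →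
      ∃ t ∈ Icc a b, σ t ∈ C := by
  suffices h : ∃ C : Set Ω, IsCompact C ∧ ∀ (σ : ℝ → Ω) (a b : ℝ), a ≤ b →
      IsUnitSpeedQuasiGeodesic E lam kap σ a b →
      (toClosure (σ a), toClosure (σ b)) ∈ A ×ˢ B → ∃ t ∈ Icc a b, σ t ∈ C by
    obtain ⟨C, hC, h⟩ := h
    exact ⟨C, hC, fun σ a b hab hσ ha hb => h σ a b hab hσ ⟨ha, hb⟩⟩
  have hint : ∀ z : closure (Ω : Set Y), (z : Y) ∈ Ω → ∃ C : Set Ω, IsCompact C ∧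
      toClosure '' C ∈ 𝓝 z := by
    intro z hz
    obtain ⟨C, hC, hCn⟩ := exists_compact_mem_nhds (⟨z, hz⟩ : Ω)
    exact ⟨C, hC, isOpenEmbedding_toClosure.isOpenMap.image_mem_nhds hCn⟩
  -- The claim is stable under finite unions of sets of endpoint pairs, so it need only hold near
  -- each pair. If one endpoint lies in `Ω`, a compact neighbourhood of it serves as `C`; otherwise
  -- both are boundary points and visibility applies.
  refine (hA.prod hB).induction_on ⟨∅, isCompact_empty, fun _ _ _ _ _ h => h.elim⟩ ?_ ?_ ?_
  · rintro s t hst ⟨C, hC, h⟩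
    exact ⟨C, hC, fun σ a b hab hσ hs => h σ a b hab hσ (hst hs)⟩
  · rintro s t ⟨C, hC, h⟩ ⟨D, hD, h'⟩
    refine ⟨C ∪ D, hC.union hD, fun σ a b hab hσ hs => ?_⟩
    rcases hs with hs | hs
    · obtain ⟨u, hu, huC⟩ := h σ a b hab hσ hs
      exact ⟨u, hu, Or.inl huC⟩
    · obtain ⟨u, hu, huC⟩ := h' σ a b hab hσ hs
      exact ⟨u, hu, Or.inr huC⟩
  · rintro ⟨p, q⟩ ⟨hp, hq⟩
    by_cases hpΩ : (p : Y) ∈ Ω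
    · obtain ⟨C, hC, hCn⟩ := hint p hpΩ
      refine ⟨(toClosure '' C) ×ˢ univ, mem_nhdsWithin_of_mem_nhds (prod_mem_nhds hCn univ_mem),
        C, hC, fun σ a b hab hσ hs => ⟨a, left_mem_Icc.2 hab, ?_⟩⟩
      exact isOpenEmbedding_toClosure.injective.mem_set_image.1 hs.1
    by_cases hqΩ : (q : Y) ∈ Ω
    · obtain ⟨C, hC, hCn⟩ := hint q hqΩ
      refine ⟨univ ×ˢ (toClosure '' C), mem_nhdsWithin_of_mem_nhds (prod_mem_nhds univ_mem hCn),
        C, hC, fun σ a b hab hσ hs => ⟨b, right_mem_Icc.2 hab, ?_⟩⟩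
      exact isOpenEmbedding_toClosure.injective.mem_set_image.1 hs.2
    have hfr : ∀ z : closure (Ω : Set Y), (z : Y) ∉ Ω → (z : Y) ∈ frontier (Ω : Set Y) :=
      fun z hz => by
        rw [Ω.isOpen.frontier_eq]
        exact ⟨z.2, hz⟩
    have hpq : (p : Y) ≠ q := fun h => disjoint_left.1 hAB hp (Subtype.ext h ▸ hq)
    obtain ⟨U, hU, V, hV, -, C, hC, h⟩ := hΩ lam kap hlam hkap p (hfr p hpΩ) q (hfr q hqΩ) hpq
    refine ⟨(Subtype.val ⁻¹' U) ×ˢ (Subtype.val ⁻¹' V), mem_nhdsWithin_of_mem_nhds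
      (prod_mem_nhds (continuous_subtype_val.continuousAt hU)
        (continuous_subtype_val.continuousAt hV)), C, hC, fun σ a b hab hσ hs => ?_⟩
    obtain ⟨t, ht, htC⟩ := h (b - a) (fun t => σ (t + a)) (sub_nonneg.2 hab)
      (hσ.isAlmostGeodesic hlam hkap.le) (by simpa [toClosure] using hs.1)
      (by simpa [toClosure] using hs.2)
    exact ⟨t + a, ⟨by linarith [ht.1], by linarith [ht.2]⟩, htC⟩

/-- Let `G` be a filter on a visibility domain such that the points of suitable members of `G` are
joined by quasi-geodesics which avoid any given compact set. Then `G` converges to a point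
of the closure or to an end. -/
theorem HasVisibilityProperty.exists_convergesTo [LocallyCompactSpace Ω] [T2Space Y]
    [LocallyCompactSpace (closure (Ω : Set Y))]
    (hΩ : HasVisibilityProperty E Ω) (K : CompactExhaustion (closure (Ω : Set Y)))
    {lam kap : ℝ} (hlam : 1 ≤ lam) (hkap : 0 < kap) {G : Filter Ω} [G.NeBot]
    (hG : ∀ C : Set Ω, IsCompact C → ∃ S ∈ G, ∀ z ∈ S, ∀ w ∈ S, ∃ (σ : ℝ → Ω) (T : ℝ), 0 ≤ T ∧
      IsUnitSpeedQuasiGeodesic E lam kap σ 0 T ∧ σ 0 = z ∧ σ T = w ∧ ∀ t ∈ Icc 0 T, σ t ∉ C) :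
    ∃ a : EndCompactification K, ConvergesTo (map toClosure G) a := by
  have hpre : ∀ {σ : ℝ → Ω} {T a b : ℝ}, IsUnitSpeedQuasiGeodesic E lam kap σ 0 T → 0 ≤ a →
      b ≤ T → IsPreconnected ((fun t => toClosure (σ t)) '' Icc a b) := fun hσ ha hb =>
    isPreconnected_Icc.image _ (isOpenEmbedding_toClosure.continuous.comp_continuousOn
      (hσ.continuousOn.mono (Icc_subset_Icc ha hb)))
  by_cases hcl : ∃ z, ClusterPt z (map toClosure G)
  · obtain ⟨z, hz⟩ := hcl
    refine ⟨.ofPoint z, fun N hN => ?_⟩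
    obtain ⟨N₁, hN₁z, hN₁N, hN₁⟩ := local_compact_nhds hN
    have hzV : z ∈ interior N₁ := mem_interior_iff_mem_nhds.2 hN₁z
    obtain ⟨A, hAz, hAV, hA⟩ := local_compact_nhds (isOpen_interior.mem_nhds hzV)
    have hB : IsCompact (frontier (interior N₁)) :=
      hN₁.of_isClosed_subset isClosed_frontier
        (frontier_subset_closure.trans (closure_minimal interior_subset hN₁.isClosed))
    have hAB : Disjoint A (frontier (interior N₁)) := by
      rw [isOpen_interior.frontier_eq]
      exact disjoint_left.2 fun w hw hw' => hw'.2 (hAV hw)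
    -- A quasi-geodesic from near `z` that leaves `interior N₁` joins `A` to the frontier, so it
    -- meets `C`; those supplied by `hG` avoid `C` and therefore stay inside.
    obtain ⟨C, hC, hCσ⟩ := hΩ.exists_isCompact hlam hkap hA hB hAB
    obtain ⟨S, hS, hSσ⟩ := hG C hC
    obtain ⟨_, hxA, x, hx, rfl⟩ := clusterPt_iff_nonempty.1 hz hAz (image_mem_map hS)
    refine mem_map.2 (mem_of_superset hS fun w hw => hN₁N (interior_subset ?_))
    obtain ⟨σ, T, hT, hσ, h0, h1, hav⟩ := hSσ x hx w hw
    by_contra hwN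
    obtain ⟨_, ⟨t, ht, rfl⟩, htf⟩ := (hpre hσ le_rfl le_rfl).exists_mem_frontier
      (V := interior N₁) ⟨0, left_mem_Icc.2 hT, rfl⟩ (by simpa only [h0] using hAV hxA)
      ⟨T, right_mem_Icc.2 hT, rfl⟩ (by simpa only [h1] using hwN)
    obtain ⟨u, hu, huC⟩ := hCσ σ 0 t ht.1 (hσ.mono le_rfl ht.2) (by rwa [h0]) htf
    exact hav u (Icc_subset_Icc_right ht.2 hu) huC
  · push Not at hcl
    -- Without cluster points the filter leaves every compact set.
    have hKc : ∀ j, (toClosure ⁻¹' (K j))ᶜ ∈ G := by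
      intro j
      by_contra hj
      have : (map toClosure G ⊓ 𝓟 (K j)).NeBot := by
        rw [neBot_iff, Ne, inf_principal_eq_bot]
        exact hj
      obtain ⟨z, -, hz⟩ := K.isCompact j (f := map toClosure G ⊓ 𝓟 (K j)) inf_le_right
      exact hcl z (hz.mono inf_le_left)
    have hcomp : ∀ j, ∃ x : Ω, toClosure x ∈ (K j)ᶜ ∧
        toClosure ⁻¹' connectedComponentIn (K j)ᶜ (toClosure x) ∈ G := by
      intro j
      have hA : IsCompact (frontier (K (j + 1))) :=
        (K.isCompact _).of_isClosed_subset isClosed_frontier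
          (K.isCompact _).isClosed.frontier_subset
      have hAB : Disjoint (frontier (K (j + 1))) (K j) :=
        disjoint_left.2 fun w hw hw' => hw.2 (K.subset_interior_succ j hw')
      obtain ⟨C, hC, hCσ⟩ := hΩ.exists_isCompact hlam hkap hA (K.isCompact j) hAB
      obtain ⟨S, hS, hSσ⟩ := hG C hC
      have hS' := inter_mem hS (hKc (j + 1))
      obtain ⟨x, hx, hxK⟩ := Filter.nonempty_of_mem hS'
      refine ⟨x, fun h => hxK (K.subset_succ j h), mem_of_superset hS' ?_⟩
      rintro w ⟨hw, hwK⟩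
      obtain ⟨σ, T, hT, hσ, h0, h1, hav⟩ := hSσ x hx w hw
      -- Starting outside `K (j + 1)`, the curve would cross the frontier of that set before
      -- reaching `K j`, and the piece in between would meet `C`. Hence `x` and `w` lie in the same
      -- component outside `K j`.
      have hKj : ∀ t ∈ Icc 0 T, toClosure (σ t) ∉ K j := by
        intro t ht htK
        obtain ⟨_, ⟨s, hs, rfl⟩, hsf⟩ := (hpre hσ le_rfl ht.2).exists_mem_frontier
          (V := K (j + 1)) ⟨t, right_mem_Icc.2 ht.1, rfl⟩ (K.subset_succ j htK)
          ⟨0, left_mem_Icc.2 ht.1, rfl⟩ (by simp only [h0]; exact hxK)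
        obtain ⟨u, hu, huC⟩ := hCσ σ s t hs.2 (hσ.mono hs.1 ht.2) hsf htK
        exact hav u ⟨hs.1.trans hu.1, hu.2.trans ht.2⟩ huC
      refine (hpre hσ le_rfl le_rfl).subset_connectedComponentIn
        ⟨0, left_mem_Icc.2 hT, by simp only [h0]⟩ ?_ ⟨T, right_mem_Icc.2 hT, by simp only [h1]⟩
      rintro _ ⟨t, ht, rfl⟩
      exact hKj t ht
    choose x hxK hxG using hcomp
    let e : TopEnd K :=
      { F := fun j => connectedComponentIn (K j)ᶜ (toClosure (x j))
        isComponent := fun j => ⟨_, hxK j, rfl⟩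
        decreasing := by
          intro j
          obtain ⟨y, hy, hy'⟩ := Filter.nonempty_of_mem (inter_mem (hxG (j + 1)) (hxG j))
          rw [connectedComponentIn_eq hy, connectedComponentIn_eq hy']
          exact connectedComponentIn_mono _ (compl_subset_compl.2 (K.subset_succ j)) }
    exact ⟨.ofEnd e, hxG⟩

end Visibility

/-- Points of `X` close to a boundary point of the metric compactification are mapped by a
quasi-isometric embedding to points that are joined by quasi-geodesics which avoid a given compact
set. -/
theorem exists_forall_quasiGeodesic_avoids
    {M : Type*} [PseudoMetricSpace M] [ProperSpace M] (hM : HasLipschitzCurves M)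
    {E' : Type*} [NormedAddCommGroup E'] [NormedSpace ℂ E'] [CompleteSpace E']
    {X' : Type*} [TopologicalSpace X'] [ChartedSpace E' X'] [IsManifold 𝓘(ℂ, E') 1 X']
    [ConnectedSpace X'] {F : M → X'} {lam kap : ℝ} (hlam : 1 ≤ lam) (hkap : 0 ≤ kap)
    (hF : ∀ x y : M, 1 / lam * dist x y - kap ≤ kobayashiDist E' (F x) (F y) ∧
      kobayashiDist E' (F x) (F y) ≤ lam * dist x y + kap)
    {ξ : MetricCompactification M} (hξ : ξ ∉ range (metricEmbedding (M := M)))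
    {C : Set X'} (hC : IsCompact C) :
    ∃ S ∈ map F (comap metricEmbedding (𝓝 ξ)), ∀ z ∈ S, ∀ w ∈ S, ∃ (σ : ℝ → X') (T : ℝ), 0 ≤ T ∧
      IsUnitSpeedQuasiGeodesic E' (lam * (lam + kap + 1)) (2 + kap + 1 + 2 * (lam + kap + 1)) σ 0 T ∧
      σ 0 = z ∧ σ T = w ∧ ∀ t ∈ Icc 0 T, σ t ∉ C := by
  have hne := neBot_comap_metricEmbedding ξ
  obtain ⟨o⟩ : Nonempty M := hne.nonempty
  have hcont : Continuous fun w : X' => kobayashiDist E' (F o) w := by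
    have h : Continuous fun w : X' =>
        dist (toKobayashiSpace (E := E') (F o)) (toKobayashiSpace w) :=
      continuous_const.dist continuous_toKobayashiSpace
    exact h
  obtain ⟨A, hA⟩ := hC.bddAbove_image hcont.continuousOn
  -- If `σ t` were in `C`, the nearby point `F (γ u)` would be within `A + (lam + kap + 1)` of `F
  -- o`, and the lower quasi-isometry bound would place `γ u` within this radius of `o`.
  obtain ⟨S, hS, hSγ⟩ := exists_forall_curve_lt_dist hξ o (lam * (A + (lam + kap + 1) + kap))
  refine ⟨F '' S, image_mem_map hS, ?_⟩
  rintro _ ⟨x, hx, rfl⟩ _ ⟨y, hy, rfl⟩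
  obtain ⟨γ, h0, h1, hγ⟩ := hM x y (dist x y + 1) (by linarith)
  obtain ⟨σ, T, hT, hσ, hσ0, hσ1, hσn⟩ :=
    exists_isUnitSpeedQuasiGeodesic_of_curve hlam hkap hF h0 h1 hγ
  refine ⟨σ, T, hT, hσ, hσ0, hσ1, fun t ht htC => ?_⟩
  obtain ⟨u, hu, hut⟩ := hσn t ht
  have e1 := hSγ x hx y hy γ h0 h1 hγ u hu
  have e2 : kobayashiDist E' (F o) (σ t) ≤ A := hA ⟨σ t, htC, rfl⟩
  have e3 := kobayashiDist_triangle (E := E') (F o) (σ t) (F (γ u))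
  rw [kobayashiDist_comm (σ t)] at e3
  have e4 := (hF o (γ u)).1
  have hl0 : 0 < lam := by linarith
  have e5 : 1 / lam * dist o (γ u) ≤ A + (lam + kap + 1) + kap := by linarith
  rw [one_div, inv_mul_le_iff₀ hl0] at e5
  linarith

end

/-! ### Construction of the extension -/

theorem theorem1p3
    {E : Type*} [NormedAddCommGroup E] [NormedSpace ℂ E] [FiniteDimensional ℂ E]
    {X : Type*} [TopologicalSpace X] [ChartedSpace E X] [IsManifold 𝓘(ℂ, E) 1 X]
    [T2Space X] [SecondCountableTopology X] [ConnectedSpace X]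
    {E' : Type*} [NormedAddCommGroup E'] [NormedSpace ℂ E'] [FiniteDimensional ℂ E']
    {Y : Type*} [TopologicalSpace Y] [ChartedSpace E' Y] [IsManifold 𝓘(ℂ, E') 1 Y]
    [T2Space Y] [SecondCountableTopology Y]
    (hX : IsKobayashiHyperbolic E X) (hXc : CompleteSpace (KobayashiSpace E X))
    (Ω : TopologicalSpace.Opens Y) (hΩ : IsConnected (Ω : Set Y)) (hΩY : Ω ≠ ⊤)
    (hΩh : IsKobayashiHyperbolic E' Ω) (hΩv : HasVisibilityProperty E' Ω)
    (K : CompactExhaustion (closure (Ω : Set Y)))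
    (F : X → Ω) (hFc : Continuous F) (hFq : IsQuasiIsometricEmbedding E E' F) :
    ∃ Fext : MetricCompactification (KobayashiSpace E X) → EndCompactification K,
      Continuous Fext ∧
        ∀ x : X, Fext (metricEmbedding (toKobayashiSpace x)) =
          EndCompactification.ofPoint ⟨(F x : Y), subset_closure (F x).2⟩ := by
  have : CompleteSpace E := FiniteDimensional.complete ℂ E
  have : CompleteSpace E' := FiniteDimensional.complete ℂ E'
  have : ProperSpace E := FiniteDimensional.proper ℂ E
  have : ProperSpace E' := FiniteDimensional.proper ℂ E'
  have : LocallyCompactSpace X := ChartedSpace.locallyCompactSpace E X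
  have : LocallyCompactSpace Y := ChartedSpace.locallyCompactSpace E' Y
  have : LocallyCompactSpace Ω := Ω.isOpen.locallyCompactSpace
  have : LocallyCompactSpace (closure (Ω : Set Y)) :=
    isClosed_closure.isClosedEmbedding_subtypeVal.locallyCompactSpace
  have : ConnectedSpace Ω := isConnected_iff_connectedSpace.1 hΩ
  have : ProperSpace (KobayashiSpace E X) := hX.properSpace
  have hM : HasLipschitzCurves (KobayashiSpace E X) := hasLipschitzCurves_kobayashiSpace X
  obtain ⟨lam, kap, hlam, hkap, hF⟩ := hFq
  let F' : KobayashiSpace E X → Ω := fun x => F (ofKobayashiSpace x)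
  have hF'c : Continuous F' := hFc.comp hX.homeomorph.symm.continuous
  have hF' : ∀ x y : KobayashiSpace E X, 1 / lam * dist x y - kap ≤ kobayashiDist E' (F' x) (F' y) ∧
      kobayashiDist E' (F' x) (F' y) ≤ lam * dist x y + kap := fun x y => hF x y
  let G : MetricCompactification (KobayashiSpace E X) → Filter (closure (Ω : Set Y)) :=
    fun ξ => map toClosure (map F' (comap metricEmbedding (𝓝 ξ)))
  have hne : ∀ ξ, (G ξ).NeBot := fun ξ => by
    have := neBot_comap_metricEmbedding ξ
    exact inferInstanceAs (map toClosure (map F' (comap metricEmbedding (𝓝 ξ)))).NeBot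
  have hGx : ∀ x, G (metricEmbedding x) ≤ 𝓝 (toClosure (F' x)) := fun x =>
    (map_mono (map_mono (hM.comap_metricEmbedding_le x))).trans
      ((isOpenEmbedding_toClosure.continuous.comp hF'c).tendsto x)
  have hconv : ∀ ξ, ∃ a : EndCompactification K, ConvergesTo (G ξ) a := by
    intro ξ
    by_cases hξ : ξ ∈ range (metricEmbedding (M := KobayashiSpace E X))
    · obtain ⟨x, rfl⟩ := hξ
      exact ⟨.ofPoint (toClosure (F' x)), hGx x⟩
    · have := neBot_comap_metricEmbedding ξ
      exact hΩv.exists_convergesTo K (by nlinarith) (by linarith)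
        fun C hC => exists_forall_quasiGeodesic_avoids hM hlam hkap hF' hξ hC
  choose Fext hFext using hconv
  refine ⟨Fext, continuous_of_convergesTo hne (fun ξ S hS => ?_) hFext, fun x => ?_⟩
  · obtain ⟨V, hV, hVS⟩ := mem_comap.1 (show F' ⁻¹' (toClosure ⁻¹' S) ∈
      comap metricEmbedding (𝓝 ξ) from hS)
    -- A neighbourhood of `ξ` is a neighbourhood of all points near `ξ`, which is the semicontinuity
    -- of `G`.
    filter_upwards [eventually_mem_nhds_iff.2 hV] with ξ' hξ'
    exact mem_comap.2 ⟨V, hξ', hVS⟩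
  -- The chosen limit is forced at points of `X`, because a filter converging to a point of the
  -- closure has no other limit, in particular no end.
  · exact (hFext _).eq_of_le_nhds (hGx (toKobayashiSpace x))
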